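/- **Definitions.** A *structured semigroup* $(S,N,Z)$ is a semigroup $S$ with subsemigroups $Z\subseteq N\subseteq S$ such that $zn=nz$ for all $z\in Z$, $n\in N$; for all $a,b\in S$, $ab,ba\in Z$ implies $aZb\cup bZa\subseteq Z$; and for all $a,b\in S$, $n\in N$, if $abn=n=nab$ and $ab,ba\in Z$ then $bna\in N$. A subset $Y\subseteq S$ is *symmetric* if $ab\in Y$ implies $baba\in Y$ for all $a,b\in S$. For $a,s,b\in S$ write $a<_s b$ if $asb=a=bsa$, $as,sa\in N$ and $bs,sb\in Z$, and $a<b$ if $a<_s b$ for some $s\in S$. For $A\subseteq S$ put $A^<=\{b: a<b \text{ for some } a\in A\}$ and $A^*=\{s: a<_s b\text{ for some }a\in A,\ b\in S\}$. A *coset* is a set $C\subseteq S$ with $CC^*C\subseteq C=C^<$; $D\subseteq S$ is *directed* if for all $a,b\in D$ there is $d\in D$ with $d<a$ and $d<b$. Let $\mathcal D(S)$ be the set of non-empty directed cosets. For $D\in\mathcal D(S)$, write $a\sim_D b$ if $a,b\in D$ and $sat=sbt$ for some $s,t\in D^*$ (so $a\not\sim_D b$ whenever $a\notin D$ or $b\notin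 D$). A groupoid is regarded as a set of arrows, with $\mathsf s(g)=g^{-1}g$, $\mathsf r(g)=gg^{-1}$, $gh$ defined iff $\mathsf s(g)=\mathsf r(h)$, and set of units $G^0$. A *topological groupoid* has continuous inverse and product, and is *étale* if moreover $\mathsf s$ is an open map. A *slice* is a set of arrows on which $\mathsf s$ and $\mathsf r$ are injective; $AB$ denotes the set of all defined products of arrows from $A$ and $B$. A *groupoid bundle* is an open continuous functor $\pi:F\to G$, injective on units, from a topological groupoid $F$ to an étale groupoid $G$. A *slice-section* of $\pi$ is a continuous map $a$ from an open slice $\mathrm{dom}(a)\subseteq G$ to $F$ with $\pi(a(g))=g$ for all $g\in\mathrm{dom}(a)$. Slice-sections are multiplied by $(ab)(gh)=a(g)b(h)$ for $g\in\mathrm{dom}(a)$, $h\in\mathrm{dom}(b)$ with $gh$ defined, so $\mathrm{dom}(ab)=\mathrm{dom}(a)\,\mathrm{dom}(b)$. A *bundle representation* of $(S,N,Z)$ on $\pi:F\to G$ is a semigroup homomorphism $\theta$ from $S$ to the slice-sections of $\pi$ such that the sets $\mathrm{dom}(\theta(a))$, $a\in S$, cover $G$; $\mathrm{dom}(\theta(n))\subseteq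 G^0$ for $n\in N$; and whenever $g\in\mathrm{dom}(\theta(a))$ there is $b<a$ with $g\in\mathrm{dom}(\theta(b))$. It is *faithful* if $\theta$ is injective. The set $\mathcal D(S)$ carries the inverse $D\mapsto D^*$, the product $B\cdot C=(BC)^<$, defined when $(B^*B)^<=(CC^*)^<$, and the topology generated by the sets $\mathcal D_a=\{D\in\mathcal D(S): a\in D\}$, $a\in S$. For $d\in D\in\mathcal D(S)$ let $[d,D]=(\{x: d\sim_D x\},D)$, and let $\widetilde{\mathcal D}(S)$ be the set of all such pairs, with product $[a,A][b,B]=[ab,A\cdot B]$ when $A\cdot B$ is defined, inverse $[c,C]^{-1}=[c',C^*]$ for any $c'$ such that $d<_{c'}c$ for some $d\in C$, and the topology generated by the sets $\{[s,D]: s\in D\in\mathcal D(S)\}$ and $\{[c,D]: c,s\in D\in\mathcal D(S)\}$, $s\in S$. The *directed coset bundle* is the projection $\rho_{\mathcal D}:\widetilde{\mathcal D}(S)\to\mathcal D(S)$, $[d,D]\mapsto D$, and the *directed coset bundle representation* $\widetilde{\mathcal D}$ sends $a\in S$ to the map $\tilde a$ with domain $\mathcal D_a$ and $\tilde a(D)=[a,D]$.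 **Corollary 11.19.** Let $(S,N,Z)$ be a structured semigroup such that $Z$ is symmetric. Then $\widetilde{\mathcal D}$ is indeed a bundle representation of $(S,N,Z)$ on $\rho_{\mathcal D}$, and the following are equivalent. 1. $(S,N,Z)$ has a faithful bundle representation. 2. The directed coset bundle representation $\widetilde{\mathcal D}$ of $(S,N,Z)$ is faithful. 3. For all distinct $a,b\in S$ there is $D\in\mathcal D(S)$ with $\{a,b\}\cap D\neq\emptyset$ and $a\not\sim_D b$. -/

import Mathlib

universe u v w

namespace BundleRep

/-! ### Groupoids, viewed as sets of arrows -/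

section Groupoids

/-- Raw operations of a groupoid regarded as a set of arrows. The value `mul g h` is only
meaningful when `g` and `h` are composable (see `Composable`); it is ignored otherwise. -/
class ArrowOps (G : Type u) where
  inv : G → G
  mul : G → G → G

open ArrowOps

/-- The source unit `s(g) = g⁻¹ g`. -/
def src {G : Type u} [ArrowOps G] (g : G) : G := mul (inv g) g

/-- The range unit `r(g) = g g⁻¹`. -/
def rng {G : Type u} [ArrowOps G] (g : G) : G := mul g (inv g)

/-- The product `gh` is defined precisely when `s(g) = r(h)`. -/
def Composable {G : Type u} [ArrowOps G] (g h : G) : Prop := src g = rng h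

/-- The units `G⁰`, i.e. the arrows `g` such that `gg` is defined and `gg = g`. -/
def units (G : Type u) [ArrowOps G] : Set G := {g | Composable g g ∧ mul g g = g}

/-- The groupoid laws: a category, all of whose arrows are invertible. -/
structure IsGroupoid (G : Type u) [ArrowOps G] : Prop where
  inv_inv : ∀ g : G, inv (inv g) = g
  src_mul : ∀ g h : G, Composable g h → src (mul g h) = src h
  rng_mul : ∀ g h : G, Composable g h → rng (mul g h) = rng g
  assoc : ∀ g h k : G, Composable g h → Composable h k → mul (mul g h) k = mul g (mul h k)
  mul_src : ∀ g : G, mul g (src g) = g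
  rng_mul_self : ∀ g : G, mul (rng g) g = g

/-- A topological groupoid: the inverse is continuous, and so is the product on the subspace of
composable pairs. -/
structure IsTopologicalGroupoid (G : Type u) [ArrowOps G] [TopologicalSpace G] : Prop where
  groupoid : IsGroupoid G
  continuous_inv : Continuous (inv : G → G)
  continuousOn_mul : ContinuousOn (fun p : G × G => mul p.1 p.2) {p | Composable p.1 p.2}

/-- An étale groupoid: a topological groupoid whose source map is open. -/
structure IsEtaleGroupoid (G : Type u) [ArrowOps G] [TopologicalSpace G] : Prop where
  topological : IsTopologicalGroupoid G
  isOpenMap_src : IsOpenMap (src : G → G)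

/-- A slice (bisection): source and range are injective on it. -/
def IsSlice {G : Type u} [ArrowOps G] (B : Set G) : Prop := Set.InjOn src B ∧ Set.InjOn rng B

/-- The product `AB` of subsets of a groupoid, over all composable pairs. -/
def setMul {G : Type u} [ArrowOps G] (A B : Set G) : Set G :=
  {k | ∃ g ∈ A, ∃ h ∈ B, Composable g h ∧ k = mul g h}

/-- A groupoid bundle: an open continuous functor, injective on units, from a topological
groupoid to an étale groupoid. -/
structure IsGroupoidBundle {F : Type v} {G : Type w} [ArrowOps F] [TopologicalSpace F]
    [ArrowOps G] [TopologicalSpace G] (π : F → G) : Prop where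
  total : IsTopologicalGroupoid F
  base : IsEtaleGroupoid G
  map_composable : ∀ e f : F, Composable e f → Composable (π e) (π f)
  map_mul : ∀ e f : F, Composable e f → π (mul e f) = mul (π e) (π f)
  injOn_units : Set.InjOn π (units F)
  continuous : Continuous π
  isOpenMap : IsOpenMap π

/-- A slice-section of `π`: a continuous partial map defined on an open slice of the base, on
which `π ∘ a` is the identity. -/
structure IsSliceSection {F : Type v} {G : Type w} [TopologicalSpace F]
    [ArrowOps G] [TopologicalSpace G] (π : F → G) (a : G →. F) : Prop where
  isOpen_dom : IsOpen a.Dom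
  isSlice_dom : IsSlice a.Dom
  continuous : Continuous (fun g : a.Dom => a.fn g.1 g.2)
  section_eq : ∀ g f, f ∈ a g → π f = g

/-- `c` is the product of the slice-sections `a` and `b`: it is the partial map defined by
`c(gh) = a(g)b(h)` for all `g` in `dom a` and `h` in `dom b` such that `gh` is defined. -/
def IsSectionProduct {F : Type v} {G : Type w} [ArrowOps F] [ArrowOps G]
    (a b c : G →. F) : Prop :=
  ∀ k f, f ∈ c k ↔
    ∃ g h x y, Composable g h ∧ x ∈ a g ∧ y ∈ b h ∧ k = mul g h ∧ f = mul x y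

end Groupoids

/-! ### Structured semigroups and domination -/

/-- A structured semigroup `(S, N, Z)`: subsemigroups `N` and `Z ⊆ Z(N)` of `S` such that `Z` is
binormal and `N` is `Z`-trinormal. -/
structure StructuredSemigroup (S : Type u) [Semigroup S] where
  N : Subsemigroup S
  Z : Subsemigroup S
  Z_le_N : Z ≤ N
  central : ∀ z ∈ Z, ∀ n ∈ N, n * z = z * n
  binormal : ∀ a b : S, a * b ∈ Z → b * a ∈ Z → ∀ z ∈ Z, a * z * b ∈ Z ∧ b * z * a ∈ Z
  trinormal : ∀ a b n : S, n ∈ N → a * b * n = n → n * (a * b) = n → a * b ∈ Z → b * a ∈ Z →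
    b * n * a ∈ N

/-- `Y ⊆ S` is symmetric if `ab ∈ Y` implies `baba ∈ Y`. -/
def IsSymmetric {S : Type u} [Semigroup S] (Y : Set S) : Prop :=
  ∀ a b : S, a * b ∈ Y → b * a * b * a ∈ Y

section Domination

open scoped Pointwise

variable {S : Type u} [Semigroup S] (T : StructuredSemigroup S)

/-- `b` dominates `a` via `s`, written `a <_s b`. -/
def DomVia (a s b : S) : Prop :=
  a * s * b = a ∧ b * s * a = a ∧ a * s ∈ T.N ∧ s * a ∈ T.N ∧ b * s ∈ T.Z ∧ s * b ∈ T.Z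

/-- The domination relation `a < b`. -/
def Dom (a b : S) : Prop := ∃ s, DomVia T a s b

/-- The up-closure `A^<`. -/
def up (A : Set S) : Set S := {b | ∃ a ∈ A, Dom T a b}

/-- The dual `A^*`. -/
def dual (A : Set S) : Set S := {s | ∃ a ∈ A, ∃ b, DomVia T a s b}

/-- The coset condition `C C^* C ⊆ C = C^<`. -/
def IsCoset (C : Set S) : Prop := C * dual T C * C ⊆ C ∧ C = up T C

/-- Any two elements of `D` dominate a common element of `D`. -/
def IsDirected (D : Set S) : Prop := ∀ a ∈ D, ∀ b ∈ D, ∃ d ∈ D, Dom T d a ∧ Dom T d b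

/-- The relation `a ∼_A b` on `A^<`: both elements lie in `A^<` and `sat = sbt` for some
`s, t ∈ A^*`. -/
def Sim (A : Set S) (a b : S) : Prop :=
  a ∈ up T A ∧ b ∈ up T A ∧ ∃ s ∈ dual T A, ∃ t ∈ dual T A, s * a * t = s * b * t

variable {T}

/-! Facts on domination used to see that the operations on directed cosets are well-defined. -/

theorem DomVia.of_left {a s b : S} (h : a * s * b = a) (hN : a * s ∈ T.N) (h1 : b * s ∈ T.Z)
    (h2 : s * b ∈ T.Z) : DomVia T a s b := by
  have hc := T.central _ h1 _ hN
  have e : b * s * a = a := by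
    calc b * s * a = b * s * (a * s * b) := by rw [h]
      _ = (b * s * (a * s)) * b := by simp only [mul_assoc]
      _ = (a * s * (b * s)) * b := by rw [hc]
      _ = (a * s * b) * s * b := by simp only [mul_assoc]
      _ = a := by rw [h, h]
  refine ⟨h, e, hN, ?_, h1, h2⟩
  have e1 : b * s * (a * s) = a * s := by rw [← mul_assoc, e]
  have e2 : a * s * (b * s) = a * s := by rw [← mul_assoc, h]
  have := T.trinormal b s (a * s) hN e1 e2 h1 h2
  have e3 : s * (a * s) * b = s * a := by rw [mul_assoc, h]
  rwa [e3] at this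

theorem DomVia.trans {a b c s t : S} (h : DomVia T a s b) (h' : DomVia T b t c) :
    DomVia T a t c := by
  obtain ⟨h1, -, h3, -, -, -⟩ := h
  obtain ⟨k1, -, k3, -, k5, k6⟩ := h'
  refine DomVia.of_left ?_ ?_ k5 k6
  · calc a * t * c = (a * s * b) * t * c := by rw [h1]
      _ = a * s * (b * t * c) := by simp only [mul_assoc]
      _ = a := by rw [k1, h1]
  · have : a * t = a * s * (b * t) := by
      rw [← mul_assoc, h1]
    rw [this]
    exact T.N.mul_mem h3 k3

theorem Dom.trans {a b c : S} (h : Dom T a b) (h' : Dom T b c) : Dom T a c :=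
  let ⟨_, h1⟩ := h
  let ⟨t, h2⟩ := h'
  ⟨t, h1.trans h2⟩

theorem DomVia.mul {a s b c t d : S} (h : DomVia T a s b) (h' : DomVia T c t d) :
    DomVia T (a * c) (t * s) (b * d) := by
  obtain ⟨h1, h2, h3, h4, h5, h6⟩ := h
  obtain ⟨k1, k2, k3, k4, k5, k6⟩ := h'
  have hc : s * b * (c * t) = c * t * (s * b) := (T.central _ h6 _ k3).symm
  have hsa : s * b * (s * a) = s * a := by
    calc s * b * (s * a) = s * (b * s * a) := by simp only [mul_assoc]
      _ = s * a := by rw [h2]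
  have hn : s * a * (c * t) ∈ T.N := T.N.mul_mem h4 k3
  refine DomVia.of_left ?_ ?_ ?_ ?_
  · calc a * c * (t * s) * (b * d) = a * (c * t * (s * b)) * d := by simp only [mul_assoc]
      _ = a * (s * b * (c * t)) * d := by rw [hc]
      _ = (a * s * b) * (c * t * d) := by simp only [mul_assoc]
      _ = a * c := by rw [h1, k1]
  · have e1 : s * b * (s * a * (c * t)) = s * a * (c * t) := by rw [← mul_assoc, hsa]
    have e2 : s * a * (c * t) * (s * b) = s * a * (c * t) := by
      rw [T.central _ h6 _ hn, e1]
    have := T.trinormal s b _ hn e1 e2 h6 h5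
    have e3 : b * (s * a * (c * t)) * s = a * c * (t * s) := by
      calc b * (s * a * (c * t)) * s = (b * s * a) * (c * t) * s := by simp only [mul_assoc]
        _ = a * c * (t * s) := by rw [h2]; simp only [mul_assoc]
    rwa [e3] at this
  · have := (T.binormal b s h5 h6 _ k5).1
    simpa only [mul_assoc] using this
  · have := (T.binormal t d k6 k5 _ h6).1
    simpa only [mul_assoc] using this

theorem Dom.mul {a b c d : S} (h : Dom T a b) (h' : Dom T c d) : Dom T (a * c) (b * d) :=
  let ⟨_, h1⟩ := h
  let ⟨_, h2⟩ := h'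
  ⟨_, h1.mul h2⟩

/-- If `a <_s b <_t c` then `a <_{sbt} c` and `sbt <_c t`. -/
theorem DomVia.interp {a s b t c : S} (h : DomVia T a s b) (h' : DomVia T b t c) :
    DomVia T a (s * b * t) c ∧ DomVia T (s * b * t) c t := by
  have ht := h.trans h'
  obtain ⟨h1, h2, h3, h4, h5, h6⟩ := h
  obtain ⟨k1, k2, k3, k4, k5, k6⟩ := h'
  have e : s * b * t * c = s * b := by
    calc s * b * t * c = s * (b * t * c) := by simp only [mul_assoc]
      _ = s * b := by rw [k1]
  refine ⟨DomVia.of_left ?_ ?_ ?_ ?_, DomVia.of_left ?_ ?_ k6 k5⟩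
  · calc a * (s * b * t) * c = a * (s * b * t * c) := by simp only [mul_assoc]
      _ = a := by rw [e, ← mul_assoc, h1]
  · have : a * (s * b * t) = a * s * (b * t) := by simp only [mul_assoc]
    rw [this]
    exact T.N.mul_mem h3 k3
  · have e' : c * (s * b * t) = c * (s * b) * t := by simp only [mul_assoc]
    rw [e']
    exact (T.binormal c t k5 k6 _ h6).1
  · rw [e]
    exact h6
  · calc s * b * t * c * t = (s * b * t * c) * t := rfl
      _ = s * b * t := by rw [e]
  · rw [e]
    exact T.Z_le_N h6

theorem dual_mono {A B : Set S} (h : A ⊆ B) : dual T A ⊆ dual T B :=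
  fun _ ⟨a, ha, b, hb⟩ => ⟨a, h ha, b, hb⟩

theorem up_mono {A B : Set S} (h : A ⊆ B) : up T A ⊆ up T B :=
  fun _ ⟨a, ha, hb⟩ => ⟨a, h ha, hb⟩

theorem up_mul_up (A B : Set S) : up T A * up T B ⊆ up T (A * B) := by
  rintro _ ⟨x, ⟨a, ha, hx⟩, y, ⟨b, hb, hy⟩, rfl⟩
  exact ⟨a * b, Set.mul_mem_mul ha hb, hx.mul hy⟩

theorem dual_mul_dual (A B : Set S) : dual T A * dual T B ⊆ dual T (B * A) := by
  rintro _ ⟨x, ⟨a, ha, c, hx⟩, y, ⟨b, hb, d, hy⟩, rfl⟩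
  exact ⟨b * a, Set.mul_mem_mul hb ha, d * c, hy.mul hx⟩

theorem dual_up_subset (A : Set S) : dual T (up T A) ⊆ up T (dual T A) := by
  rintro t ⟨b, ⟨a, ha, s, hs⟩, c, hc⟩
  exact ⟨s * b * t, ⟨a, ha, c, (hs.interp hc).1⟩, c, (hs.interp hc).2⟩

theorem up_up_subset (A : Set S) : up T (up T A) ⊆ dual T (dual T A) := by
  rintro c ⟨b, ⟨a, ha, s, hs⟩, t, hc⟩
  exact ⟨s * b * t, ⟨a, ha, c, (hs.interp hc).1⟩, t, (hs.interp hc).2⟩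

/-- If `c <_s b` and `s <_a t` then `csasc <_t a`. -/
theorem DomVia.swap {c s b a t : S} (h : DomVia T c s b) (h' : DomVia T s a t) :
    DomVia T (c * s * a * s * c) t a := by
  obtain ⟨-, -, h3, h4, -, -⟩ := h
  obtain ⟨k1, k2, k3, k4, k5, k6⟩ := h'
  have hc : s * c * (t * a) = t * a * (s * c) := T.central _ k5 _ h4
  have e1 : t * a * (s * c) = s * c := by rw [← mul_assoc, k2]
  refine DomVia.of_left ?_ ?_ k6 k5
  · calc c * s * a * s * c * t * a = c * s * a * (s * c * (t * a)) := by simp only [mul_assoc]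
      _ = c * s * a * s * c := by rw [hc, e1]; simp only [mul_assoc]
  · have := T.trinormal t a _ h4 e1 (by rw [hc, e1]) k5 k6
    have e : c * s * a * s * c * t = c * s * (a * (s * c) * t) := by simp only [mul_assoc]
    rw [e]
    exact T.N.mul_mem h3 this

theorem up_dual_subset {A : Set S} (hA : A * dual T A * A ⊆ A) :
    up T (dual T A) ⊆ dual T A := by
  rintro t ⟨s, ⟨c, hc, b, hb⟩, a, ha⟩
  refine ⟨_, ?_, a, hb.swap ha⟩
  have hs : s ∈ dual T A := ⟨c, hc, b, hb⟩
  have ha' : a ∈ dual T (dual T A) := ⟨s, hs, t, ha⟩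
  have hsas : s * a * s ∈ dual T A := by
    refine dual_mono hA ?_
    refine dual_mul_dual _ _ ?_
    have h2 := dual_mul_dual A (dual T A) (Set.mul_mem_mul hs ha')
    rw [mul_assoc]
    exact Set.mul_mem_mul hs (dual_mul_dual _ _ (Set.mul_mem_mul ha' hs))
  have e : c * s * a * s * c = c * (s * a * s) * c := by simp only [mul_assoc]
  rw [e]
  exact hA (Set.mul_mem_mul (Set.mul_mem_mul hc hsas) hc)

theorem IsDirected.subset_up {A : Set S} (h : IsDirected T A) : A ⊆ up T A := by
  intro a ha
  obtain ⟨d, hd, h1, -⟩ := h a ha a ha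
  exact ⟨d, hd, h1⟩

theorem up_up {A : Set S} (h : A ⊆ up T A) : up T (up T A) = up T A := by
  apply Set.Subset.antisymm
  · rintro c ⟨b, ⟨a, ha, hab⟩, hbc⟩
    exact ⟨a, ha, hab.trans hbc⟩
  · exact up_mono h

theorem IsDirected.up {A : Set S} (h : IsDirected T A) : IsDirected T (up T A) := by
  rintro x ⟨a, ha, hx⟩ y ⟨b, hb, hy⟩
  obtain ⟨d, hd, h1, h2⟩ := h a ha b hb
  exact ⟨d, h.subset_up hd, h1.trans hx, h2.trans hy⟩

theorem IsDirected.mul {A B : Set S} (hA : IsDirected T A) (hB : IsDirected T B) :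
    IsDirected T (A * B) := by
  rintro _ ⟨a, ha, b, hb, rfl⟩ _ ⟨c, hc, d, hd, rfl⟩
  obtain ⟨x, hx, h1, h2⟩ := hA a ha c hc
  obtain ⟨y, hy, h3, h4⟩ := hB b hb d hd
  exact ⟨x * y, Set.mul_mem_mul hx hy, h1.mul h3, h2.mul h4⟩

theorem IsDirected.dual {D : Set S} (h : IsDirected T D) : IsDirected T (dual T D) := by
  rintro s ⟨a, ha, b, hs⟩ t ⟨c, hc, d, ht⟩
  obtain ⟨f, hf, hfa, hfc⟩ := h a ha c hc
  obtain ⟨e, he, ⟨f', hef⟩, -⟩ := h f hf f hf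
  obtain ⟨_, hfa⟩ := hfa
  obtain ⟨_, hfc⟩ := hfc
  have hs := hfa.trans hs
  have ht := hfc.trans ht
  obtain ⟨s1, s2, s3, s4, s5, s6⟩ := hs
  obtain ⟨t1, t2, t3, t4, t5, t6⟩ := ht
  obtain ⟨e1, e2, e3, e4, e5, e6⟩ := hef
  have hbs : f * t * (b * s) = b * s * (f * t) := T.central _ s5 _ t3
  refine ⟨s * f * t, ⟨e, he, d * f' * b, DomVia.of_left ?_ ?_ ?_ ?_⟩, ⟨b, ?_⟩, ⟨d, ?_⟩⟩
  · have hes : e * s ∈ T.N := by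
      have : e * s = e * f' * (f * s) := by rw [← mul_assoc, e1]
      rw [this]
      exact T.N.mul_mem e3 s3
    have hff : f' * e * (f' * f) = f' * e := by
      calc f' * e * (f' * f) = f' * (e * f' * f) := by simp only [mul_assoc]
        _ = f' * e := by rw [e1]
    calc e * (s * f * t) * (d * f' * b) = e * s * (f * t * d) * f' * b := by
          simp only [mul_assoc]
      _ = e * s * (f * f') * b := by rw [t1]; simp only [mul_assoc]
      _ = f * f' * (e * s) * b := by rw [T.central _ e5 _ hes]
      _ = (f * f' * e) * s * b := by simp only [mul_assoc]
      _ = e * s * b := by rw [e2]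
      _ = (e * f' * f) * s * b := by rw [e1]
      _ = e * f' * (f * s * b) := by simp only [mul_assoc]
      _ = e := by rw [s1, e1]
  · have hes : e * s ∈ T.N := by
      have : e * s = e * f' * (f * s) := by rw [← mul_assoc, e1]
      rw [this]
      exact T.N.mul_mem e3 s3
    have : e * (s * f * t) = e * s * (f * t) := by simp only [mul_assoc]
    rw [this]
    exact T.N.mul_mem hes t3
  · have e' : d * f' * b * (s * f * t) = d * (f' * f) * t := by
      calc d * f' * b * (s * f * t) = d * f' * (b * s * f) * t := by simp only [mul_assoc]
        _ = d * (f' * f) * t := by rw [s2]; simp only [mul_assoc]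
    rw [e']
    exact (T.binormal d t t5 t6 _ e6).1
  · have e' : s * f * t * (d * f' * b) = s * (f * f') * b := by
      calc s * f * t * (d * f' * b) = s * (f * t * d) * f' * b := by simp only [mul_assoc]
        _ = s * (f * f') * b := by rw [t1]; simp only [mul_assoc]
    rw [e']
    exact (T.binormal s b s6 s5 _ e5).1
  · refine DomVia.of_left ?_ ?_ s6 s5
    · have : s * f * t * b * s = s * (f * t * (b * s)) := by simp only [mul_assoc]
      rw [this, hbs]
      calc s * (b * s * (f * t)) = s * (b * s * f) * t := by simp only [mul_assoc]
        _ = s * f * t := by rw [s2]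
    · have hn : s * (f * t) * b ∈ T.N := by
        have q1 : b * s * (f * t) = f * t := by rw [← mul_assoc, s2]
        exact T.trinormal b s _ t3 q1 (by rw [hbs, q1]) s5 s6
      simpa only [mul_assoc] using hn
  · refine DomVia.of_left ?_ ?_ t6 t5
    · calc s * f * t * d * t = s * (f * t * d) * t := by simp only [mul_assoc]
        _ = s * f * t := by rw [t1]
    · have : s * f * t * d = s * f := by
        calc s * f * t * d = s * (f * t * d) := by simp only [mul_assoc]
          _ = s * f := by rw [t1]
      rw [this]
      exact s4

theorem dual_nonempty {A : Set S} (h : IsDirected T A) (hA : A.Nonempty) :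
    (dual T A).Nonempty := by
  obtain ⟨a, ha⟩ := hA
  obtain ⟨d, hd, ⟨s, hs⟩, -⟩ := h a ha a ha
  exact ⟨s, d, hd, a, hs⟩

theorem IsCoset.dual {C : Set S} (h : IsCoset T C) : IsCoset T (dual T C) := by
  constructor
  · refine Set.Subset.trans ?_ (dual_mono h.1)
    refine Set.Subset.trans (Set.mul_subset_mul_right (dual_mul_dual _ _)) ?_
    refine Set.Subset.trans (dual_mul_dual _ _) (dual_mono ?_)
    rw [mul_assoc]
  · apply Set.Subset.antisymm
    · have := dual_up_subset (T := T) C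
      rwa [← h.2] at this
    · exact up_dual_subset h.1

/-- Composable directed cosets have a coset as their product. -/
theorem isCoset_up_mul {A B : Set S} (hA : IsCoset T A) (hB : IsCoset T B)
    (dA : IsDirected T A) (dB : IsDirected T B) (h : dual T A * A ⊆ up T (B * dual T B)) :
    IsCoset T (up T (A * B)) := by
  have hr : A * B ⊆ up T (A * B) := (dA.mul dB).subset_up
  have h1 : dual T A * A * B ⊆ B := by
    refine Set.Subset.trans (Set.mul_subset_mul h dB.subset_up) ?_
    refine Set.Subset.trans (up_mul_up _ _) ?_
    exact Set.Subset.trans (up_mono hB.1) hB.2.symm.subset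
  have h2 : dual T (A * B) * A ⊆ dual T B := by
    have hAA : A ⊆ dual T (dual T A) := by
      have := up_up_subset (T := T) A
      rwa [← hA.2, ← hA.2] at this
    refine Set.Subset.trans (Set.mul_subset_mul_left hAA) ?_
    refine Set.Subset.trans (dual_mul_dual _ _) (dual_mono ?_)
    rw [← mul_assoc]
    exact h1
  have h3 : A * B * dual T (A * B) * (A * B) ⊆ A * B := by
    have e : A * B * dual T (A * B) * (A * B) = A * (B * (dual T (A * B) * A) * B) := by
      simp only [mul_assoc]
    rw [e]
    refine Set.mul_subset_mul_left (Set.Subset.trans ?_ hB.1)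
    exact Set.mul_subset_mul_right (Set.mul_subset_mul_left h2)
  refine ⟨?_, (up_up hr).symm⟩
  have h4 : dual T (up T (A * B)) ⊆ up T (dual T (A * B)) := dual_up_subset _
  refine Set.Subset.trans (Set.mul_subset_mul_right (Set.mul_subset_mul_left h4)) ?_
  refine Set.Subset.trans (Set.mul_subset_mul_right (up_mul_up _ _)) ?_
  exact Set.Subset.trans (up_mul_up _ _) (up_mono h3)

end Domination

/-! ### Representations -/

section Representations

variable {S : Type u} [Semigroup S]

/-- An étale representation of `(S, N, Z)` on an étale groupoid `G`: a homomorphism to the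
semigroup of open slices of `G` whose values cover `G`, which maps `N` to sets of units, and which
is locally round. -/
structure IsEtaleRepresentation (T : StructuredSemigroup S) {G : Type w} [ArrowOps G]
    [TopologicalSpace G] (θ : S → Set G) : Prop where
  etale : IsEtaleGroupoid G
  isOpen : ∀ a, IsOpen (θ a)
  isSlice : ∀ a, IsSlice (θ a)
  map_mul : ∀ a b, θ (a * b) = setMul (θ a) (θ b)
  cover : ∀ g, ∃ a, g ∈ θ a
  map_N : ∀ n ∈ T.N, θ n ⊆ units G
  locallyRound : ∀ g a, g ∈ θ a → ∃ b, Dom T b a ∧ g ∈ θ b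

/-- A bundle representation of `(S, N, Z)` on a groupoid bundle `π : F → G`: a homomorphism to the
semigroup of slice-sections of `π` whose domains form an étale representation. -/
structure IsBundleRepresentation (T : StructuredSemigroup S) {F : Type v} {G : Type w}
    [ArrowOps F] [TopologicalSpace F] [ArrowOps G] [TopologicalSpace G]
    (π : F → G) (θ : S → (G →. F)) : Prop where
  bundle : IsGroupoidBundle π
  isSliceSection : ∀ a, IsSliceSection π (θ a)
  map_mul : ∀ a b, IsSectionProduct (θ a) (θ b) (θ (a * b))
  etale_dom : IsEtaleRepresentation T (fun a => (θ a).Dom)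

/-- `(S, N, Z)` has a faithful (i.e. injective) bundle representation. -/
def HasFaithfulBundleRepresentation (T : StructuredSemigroup S) : Prop :=
  ∃ (F : Type v) (G : Type w) (_ : ArrowOps F) (_ : TopologicalSpace F) (_ : ArrowOps G)
    (_ : TopologicalSpace G) (π : F → G) (θ : S → (G →. F)),
    IsBundleRepresentation T π θ ∧ Function.Injective θ

end Representations

/-! ### The directed coset bundle -/

section DirectedCosets

open scoped Pointwise

variable {S : Type u} [Semigroup S]

/-- The set `𝒟(S)` of non-empty directed cosets. -/
@[ext]
structure DirCoset (T : StructuredSemigroup S) where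
  carrier : Set S
  nonempty : carrier.Nonempty
  isCoset : IsCoset T carrier
  isDirected : IsDirected T carrier

variable {T : StructuredSemigroup S}

/-- The inverse `C ↦ C^*` on directed cosets. -/
def DirCoset.inv (C : DirCoset T) : DirCoset T where
  carrier := dual T C.carrier
  nonempty := dual_nonempty C.isDirected C.nonempty
  isCoset := C.isCoset.dual
  isDirected := C.isDirected.dual

/-- The condition `s(B) = r(C)`, i.e. `(B^* B)^< = (C C^*)^<`. -/
def DirCoset.Matches (B C : DirCoset T) : Prop :=
  up T (dual T B.carrier * B.carrier) = up T (C.carrier * dual T C.carrier)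

/-- The product `B · C = (BC)^<` of directed cosets with `s(B) = r(C)`. -/
def DirCoset.prod (B C : DirCoset T) (h : B.Matches C) : DirCoset T where
  carrier := up T (B.carrier * C.carrier)
  nonempty := (B.nonempty.mul C.nonempty).mono (B.isDirected.mul C.isDirected).subset_up
  isCoset := isCoset_up_mul B.isCoset C.isCoset B.isDirected C.isDirected
    (Set.Subset.trans (B.isDirected.dual.mul B.isDirected).subset_up h.subset)
  isDirected := (B.isDirected.mul C.isDirected).up

open Classical in
/-- The groupoid operations on directed cosets (the product of cosets that do not match is
irrelevant). -/
noncomputable instance : ArrowOps (DirCoset T) where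
  inv C := C.inv
  mul B C := if h : B.Matches C then B.prod C h else B

/-- The canonical topology on directed cosets, generated by the sets `𝒟_a = {D : a ∈ D}`. -/
instance : TopologicalSpace (DirCoset T) :=
  TopologicalSpace.generateFrom (Set.range fun a : S => {D : DirCoset T | a ∈ D.carrier})

/-- The total space of the directed coset bundle: pairs `[d, D]` consisting of the
`∼_D`-equivalence class of some `d ∈ D` and the directed coset `D`. -/
@[ext]
structure DirGerm (T : StructuredSemigroup S) where
  cls : Set S
  base : DirCoset T
  exists_rep : ∃ d ∈ base.carrier, cls = {x | Sim T base.carrier d x}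

/-- The pair `[d, D]`. -/
def DirGerm.mk' (d : S) (D : DirCoset T) (h : d ∈ D.carrier) : DirGerm T :=
  ⟨{x | Sim T D.carrier d x}, D, d, h, rfl⟩

/-- A chosen `d` with `p = [d, D]`. -/
noncomputable def DirGerm.rep (p : DirGerm T) : S := p.exists_rep.choose

theorem DirGerm.rep_mem (p : DirGerm T) : p.rep ∈ p.base.carrier := p.exists_rep.choose_spec.1

theorem DirGerm.mk_rep (p : DirGerm T) : DirGerm.mk' p.rep p.base p.rep_mem = p :=
  DirGerm.ext p.exists_rep.choose_spec.2.symm rfl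

theorem DirGerm.exists_inv (p : DirGerm T) :
    ∃ c', ∃ d ∈ p.base.carrier, DomVia T d c' p.rep := by
  obtain ⟨d, hd, ⟨s, hs⟩, -⟩ := p.base.isDirected _ p.rep_mem _ p.rep_mem
  exact ⟨s, d, hd, hs⟩

open Classical in
/-- The groupoid operations on the total space: `[a, A][b, B] = [ab, A · B]` when `s(A) = r(B)`,
and `[c, C]⁻¹ = [c', C^*]` for any `c'` such that `d <_{c'} c` for some `d ∈ C` (neither depends on
the choice of representatives or of `c'`; products of other pairs are irrelevant). -/
noncomputable instance : ArrowOps (DirGerm T) where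
  inv p := DirGerm.mk' p.exists_inv.choose p.base.inv
    ⟨_, p.exists_inv.choose_spec.choose_spec.1, _, p.exists_inv.choose_spec.choose_spec.2⟩
  mul p q := if h : p.base.Matches q.base then
    DirGerm.mk' (p.rep * q.rep) (p.base.prod q.base h)
      ((p.base.isDirected.mul q.base.isDirected).subset_up
        (Set.mul_mem_mul p.rep_mem q.rep_mem))
    else p

/-- The canonical topology on the total space, generated by the sets `{[s, D] : s ∈ D}` and
`{[c, D] : c, s ∈ D}` for `s ∈ S`. -/
instance : TopologicalSpace (DirGerm T) :=
  TopologicalSpace.generateFrom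
    ((Set.range fun s : S => {p : DirGerm T | ∃ h : s ∈ p.base.carrier, p = .mk' s p.base h}) ∪
      Set.range fun s : S => {p : DirGerm T | s ∈ p.base.carrier})

/-- The directed coset bundle `[d, D] ↦ D`. -/
def dirCosetBundle (T : StructuredSemigroup S) : DirGerm T → DirCoset T := DirGerm.base

/-- The directed coset bundle representation `a ↦ ã`, where `ã` is defined on
`𝒟_a = {D : a ∈ D}` by `ã(D) = [a, D]`. -/
def dirCosetRep (T : StructuredSemigroup S) (a : S) : DirCoset T →. DirGerm T :=
  fun D => ⟨a ∈ D.carrier, fun h => DirGerm.mk' a D h⟩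

end DirectedCosets

end BundleRep

universe v' w'

namespace BundleRep

open ArrowOps

open scoped Pointwise Topology

/-! The directed cosets form an étale groupoid in which `𝒟_a` is an open slice. A directed coset is
determined by its source and any one of its elements (`eq_up_singleton_mul_srcSet`), it is a unit
once it meets `N` (`carrier_eq_srcSet`), and units lift along the source map (`exists_srcSet_eq`),
which makes that map open. Symmetry of `Z` gives `𝒟_{ab} ⊆ 𝒟_a 𝒟_b` (`exists_prod_eq`), so that `a ↦
𝒟_a` is multiplicative.

The relations `∼_D` are compatible with products and inverses (`sim_mul`, `sim_inv`) and persist on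
a neighbourhood of `D` (`isOpen_sim`). The classes `[d, D]` therefore form a topological groupoid
over `𝒟(S)`, and `a ↦ ã` is a bundle representation. Since `ã(D) = b̃(D)` means `a ∼_D b`, its
faithfulness is exactly the separation condition.

It remains to derive separation from an arbitrary faithful `θ`. For `g ∈ dom θ(a)`, the set `P = {c
: g ∈ dom θ(c)}` is up-closed with `P P^* P ⊆ P`, but need not be directed. Local roundness yields a
descending sequence in `P` starting at `a`, and the coset it generates is a directed coset `D ⊆ P`
containing `a` (`exists_dirCoset`). If `sat = sbt` with `s, t ∈ D^*`, then `θ(s)` and `θ(t)` are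
defined at `g⁻¹`, and cancellation in `F` gives `θ(a)(g) = θ(b)(g)` (`eq_of_sim`). So elements that
no `D` separates have the same image under `θ`. -/

theorem injective_map_up {S : Type u} {F : Type v} {G : Type w} {θ : S → (G →. F)}
    (h : Function.Injective θ) : Function.Injective
    (fun a => (fun g => (θ a g.down).map ULift.up : ULift.{w'} G →. ULift.{v'} F)) := by
  intro a b hab
  refine h (funext fun g => ?_)
  have e : (θ a g).map ULift.up = (θ b g).map ULift.up := congrFun hab ⟨g⟩
  have key : ∀ o : Part F, (o.map ULift.up.{v'}).map ULift.down = o := fun o => by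
    rw [Part.map_map]; exact Part.map_id' (fun _ => rfl) o
  exact (key _).symm.trans ((congrArg _ e).trans (key _))

variable {S : Type u} [Semigroup S] {T : StructuredSemigroup S}

/-! ### Up-closures of products of round sets -/

theorem subset_up_mul {X Y : Set S} (hX : X ⊆ up T X) (hY : Y ⊆ up T Y) :
    X * Y ⊆ up T (X * Y) :=
  (Set.mul_subset_mul hX hY).trans (up_mul_up _ _)

/-- Roundness and transitivity of `<` make up-closure idempotent, so inner up-closures can be
dropped. With the mirror image below, this reduces identities between products of cosets to
associativity of set products. -/
theorem up_up_mul {X Y : Set S} (hX : X ⊆ up T X) (hY : Y ⊆ up T Y) :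
    up T (up T X * Y) = up T (X * Y) := by
  apply Set.Subset.antisymm
  · have h : up T X * Y ⊆ up T (X * Y) :=
      (Set.mul_subset_mul_left hY).trans (up_mul_up _ _)
    exact (up_mono h).trans (up_up (subset_up_mul hX hY)).subset
  · exact up_mono (Set.mul_subset_mul_right hX)

theorem up_mul_up_right {X Y : Set S} (hX : X ⊆ up T X) (hY : Y ⊆ up T Y) :
    up T (X * up T Y) = up T (X * Y) := by
  apply Set.Subset.antisymm
  · have h : X * up T Y ⊆ up T (X * Y) :=
      (Set.mul_subset_mul_right hX).trans (up_mul_up _ _)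
    exact (up_mono h).trans (up_up (subset_up_mul hX hY)).subset
  · exact up_mono (Set.mul_subset_mul_left hY)

/-- The up-closure of a round set `X` with `X X^* X ⊆ X` is a coset. -/
theorem isCoset_up {X : Set S} (hX : X ⊆ up T X) (h : X * dual T X * X ⊆ X) :
    IsCoset T (up T X) := by
  refine ⟨?_, (up_up hX).symm⟩
  refine Set.Subset.trans (Set.mul_subset_mul_right
    (Set.mul_subset_mul_left (dual_up_subset _))) ?_
  refine Set.Subset.trans (Set.mul_subset_mul_right (up_mul_up _ _)) ?_
  exact Set.Subset.trans (up_mul_up _ _) (up_mono h)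

/-- If `d <_s c` then `s ∈ X^*`, and `d = dsc` is already a triple product below `c`. -/
theorem subset_up_triple {X : Set S} (h : IsDirected T X) :
    X ⊆ up T (X * dual T X * X) := by
  intro c hc
  obtain ⟨d, hd, ⟨s, hs⟩, -⟩ := h c hc c hc
  refine ⟨d, ?_, s, hs⟩
  rw [← hs.1]
  exact Set.mul_mem_mul (Set.mul_mem_mul hd ⟨d, hd, c, hs⟩) hc

/-! ### Duals, sources, ranges and products of directed cosets -/

namespace DirCoset

theorem up_eq (C : DirCoset T) : up T C.carrier = C.carrier := C.isCoset.2.symm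

theorem round (C : DirCoset T) : C.carrier ⊆ up T C.carrier := C.up_eq.symm.subset

theorem round_dual (C : DirCoset T) : dual T C.carrier ⊆ up T (dual T C.carrier) :=
  C.inv.round

theorem mem_of_dom (C : DirCoset T) {a b : S} (ha : a ∈ C.carrier) (h : Dom T a b) :
    b ∈ C.carrier := by
  rw [← C.up_eq]; exact ⟨a, ha, h⟩

theorem exists_domVia (C : DirCoset T) {a : S} (ha : a ∈ C.carrier) :
    ∃ d ∈ C.carrier, ∃ s ∈ dual T C.carrier, DomVia T d s a := by
  obtain ⟨d, hd, ⟨s, hs⟩, -⟩ := C.isDirected a ha a ha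
  exact ⟨d, hd, s, ⟨d, hd, a, hs⟩, hs⟩

theorem triple_mem (C : DirCoset T) {a s b : S} (ha : a ∈ C.carrier) (hs : s ∈ dual T C.carrier)
    (hb : b ∈ C.carrier) : a * s * b ∈ C.carrier :=
  C.isCoset.1 (Set.mul_mem_mul (Set.mul_mem_mul ha hs) hb)

theorem up_triple (C : DirCoset T) :
    up T (C.carrier * dual T C.carrier * C.carrier) = C.carrier :=
  Set.Subset.antisymm ((up_mono C.isCoset.1).trans C.up_eq.subset) (subset_up_triple C.isDirected)

/-- If `c <_s b` and `s <_t a`, then `csasc <_t a` with `csasc` in `C C^* C ⊆ C`, which puts `a` in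
`C`. The converse is interpolation applied to `C = C^<^<`. -/
theorem dual_dual (C : DirCoset T) : dual T (dual T C.carrier) = C.carrier := by
  apply Set.Subset.antisymm
  · rintro a ⟨s, hs, t, ha⟩
    obtain ⟨c, hc, b, hb⟩ := hs
    have hs : s ∈ dual T C.carrier := ⟨c, hc, b, hb⟩
    have ha' : a ∈ dual T (dual T C.carrier) := ⟨s, hs, t, ha⟩
    have hsas : s * a * s ∈ dual T C.carrier :=
      C.inv.isCoset.1 (Set.mul_mem_mul (Set.mul_mem_mul hs ha') hs)
    refine C.mem_of_dom ?_ ⟨t, hb.swap ha⟩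
    have := C.triple_mem hc hsas hc
    simpa only [mul_assoc] using this
  · have := up_up_subset (T := T) C.carrier
    rwa [C.up_eq, C.up_eq] at this

theorem inv_inv' (C : DirCoset T) : C.inv.inv = C := DirCoset.ext C.dual_dual

/-- The carrier of the source unit of a directed coset. -/
def srcSet (C : DirCoset T) : Set S := up T (dual T C.carrier * C.carrier)

/-- The carrier of the range unit of a directed coset. -/
def rngSet (C : DirCoset T) : Set S := up T (C.carrier * dual T C.carrier)

theorem matches_iff {B C : DirCoset T} : B.Matches C ↔ B.srcSet = C.rngSet := Iff.rfl

theorem srcSet_inv (C : DirCoset T) : C.inv.srcSet = C.rngSet := by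
  change up T (dual T (dual T C.carrier) * dual T C.carrier) = _
  rw [C.dual_dual]; rfl

theorem rngSet_inv (C : DirCoset T) : C.inv.rngSet = C.srcSet := by
  change up T (dual T C.carrier * dual T (dual T C.carrier)) = _
  rw [C.dual_dual]; rfl

theorem Matches.inv {B C : DirCoset T} (h : B.Matches C) : C.inv.Matches B.inv := by
  rw [matches_iff, srcSet_inv, rngSet_inv]; exact h.symm

theorem inv_matches (C : DirCoset T) : C.inv.Matches C := C.srcSet_inv

theorem matches_inv (C : DirCoset T) : C.Matches C.inv := C.rngSet_inv.symm

theorem mul_mem_srcSet (C : DirCoset T) {s c : S} (hs : s ∈ dual T C.carrier)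
    (hc : c ∈ C.carrier) : s * c ∈ C.srcSet :=
  subset_up_mul C.round_dual C.round (Set.mul_mem_mul hs hc)

theorem mul_mem_rngSet (C : DirCoset T) {s c : S} (hc : c ∈ C.carrier)
    (hs : s ∈ dual T C.carrier) : c * s ∈ C.rngSet :=
  subset_up_mul C.round C.round_dual (Set.mul_mem_mul hc hs)

theorem mul_srcSet_subset (C : DirCoset T) : C.carrier * C.srcSet ⊆ C.carrier := by
  refine (Set.mul_subset_mul_right C.round).trans ((up_mul_up _ _).trans ?_)
  rw [← mul_assoc, C.up_triple]

theorem rngSet_mul_subset (C : DirCoset T) : C.rngSet * C.carrier ⊆ C.carrier := by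
  refine (Set.mul_subset_mul_left C.round).trans ((up_mul_up _ _).trans ?_)
  rw [C.up_triple]

/-- Any `f` below both `x` and `e` has the form `x(x'f)` with `x'f ∈ C^* C`. This is why `𝒟_x` is a
slice. -/
theorem eq_up_singleton_mul_srcSet (C : DirCoset T) {x : S} (hx : x ∈ C.carrier) :
    C.carrier = up T ({x} * C.srcSet) := by
  apply Set.Subset.antisymm
  · intro e he
    obtain ⟨f, hf, ⟨x', hx'⟩, hfe⟩ := C.isDirected x hx e he
    refine ⟨f, ?_, hfe⟩
    have hfx := hx'.2.1
    rw [← hfx, mul_assoc]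
    exact Set.mul_mem_mul rfl (C.mul_mem_srcSet ⟨f, hf, x, hx'⟩ hf)
  · refine (up_mono ?_).trans C.up_eq.subset
    exact (Set.mul_subset_mul_right (Set.singleton_subset_iff.2 hx)).trans C.mul_srcSet_subset

/-- Intersecting directed cosets with the same source coincide. -/
theorem eq_of_srcSet_eq {B C : DirCoset T} (h : B.srcSet = C.srcSet) {x : S}
    (hB : x ∈ B.carrier) (hC : x ∈ C.carrier) : B = C := by
  apply DirCoset.ext
  rw [B.eq_up_singleton_mul_srcSet hB, C.eq_up_singleton_mul_srcSet hC, h]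

/-- Intersecting directed cosets with the same range coincide. -/
theorem eq_of_rngSet_eq {B C : DirCoset T} (h : B.rngSet = C.rngSet) {x : S}
    (hB : x ∈ B.carrier) (hC : x ∈ C.carrier) : B = C := by
  apply DirCoset.ext
  have key : ∀ C : DirCoset T, x ∈ C.carrier → C.carrier = up T (C.rngSet * {x}) := by
    intro C hx
    apply Set.Subset.antisymm
    · intro e he
      obtain ⟨f, hf, ⟨x', hx'⟩, hfe⟩ := C.isDirected x hx e he
      refine ⟨f, ?_, hfe⟩
      have hfx := hx'.1
      rw [← hfx]
      exact Set.mul_mem_mul (C.mul_mem_rngSet hf ⟨f, hf, x, hx'⟩) rfl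
    · refine (up_mono ?_).trans C.up_eq.subset
      exact (Set.mul_subset_mul_left (Set.singleton_subset_iff.2 hx)).trans C.rngSet_mul_subset
  rw [key B hB, key C hC, h]

/-- Writing `A` as `A^{**}` turns the left side into a product of duals, contained in the dual of
`A^* A B`. Matching puts `A^* A` inside the range of `B`, which maps `B` into itself. -/
theorem dual_mul_subset {A B : DirCoset T} (h : A.Matches B) :
    dual T (A.carrier * B.carrier) * A.carrier ⊆ dual T B.carrier := by
  have hAB : dual T A.carrier * A.carrier * B.carrier ⊆ B.carrier := by
    refine (Set.mul_subset_mul_right ?_).trans B.rngSet_mul_subset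
    rw [← matches_iff.1 h]
    exact subset_up_mul A.round_dual A.round
  calc dual T (A.carrier * B.carrier) * A.carrier
      = dual T (A.carrier * B.carrier) * dual T (dual T A.carrier) := by rw [A.dual_dual]
    _ ⊆ dual T (dual T A.carrier * (A.carrier * B.carrier)) := dual_mul_dual _ _
    _ ⊆ dual T B.carrier := dual_mono (by rwa [← mul_assoc])

theorem mul_dual_subset {A B : DirCoset T} (h : A.Matches B) :
    B.carrier * dual T (A.carrier * B.carrier) ⊆ dual T A.carrier := by
  have hAB : A.carrier * (B.carrier * dual T B.carrier) ⊆ A.carrier := by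
    refine (Set.mul_subset_mul_left ?_).trans A.mul_srcSet_subset
    rw [matches_iff.1 h]
    exact subset_up_mul B.round B.round_dual
  calc B.carrier * dual T (A.carrier * B.carrier)
      = dual T (dual T B.carrier) * dual T (A.carrier * B.carrier) := by rw [B.dual_dual]
    _ ⊆ dual T ((A.carrier * B.carrier) * dual T B.carrier) := dual_mul_dual _ _
    _ ⊆ dual T A.carrier := dual_mono (by rwa [mul_assoc])

/-- If `x <_t y` then `txt <_y t`. -/
theorem _root_.BundleRep.DomVia.conj {x t y : S} (h : DomVia T x t y) :
    DomVia T (t * x * t) y t := by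
  obtain ⟨h1, h2, h3, h4, h5, h6⟩ := h
  have e : t * x * t * y = t * x := by
    calc t * x * t * y = t * (x * t * y) := by simp only [mul_assoc]
      _ = t * x := by rw [h1]
  exact DomVia.of_left (by rw [e]) (by rwa [e]) h6 h5

theorem dual_prod {A B : DirCoset T} (h : A.Matches B) :
    dual T (up T (A.carrier * B.carrier)) = up T (dual T B.carrier * dual T A.carrier) := by
  have hr := subset_up_mul A.round B.round
  apply Set.Subset.antisymm
  · have hr' := subset_up_mul B.round_dual A.round_dual
    refine (dual_up_subset _).trans ((up_mono ?_).trans (up_up hr').subset)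
    rintro t ⟨_, ⟨a, ha, b, hb, rfl⟩, y, ht⟩
    have ht' : t ∈ dual T (A.carrier * B.carrier) := ⟨_, ⟨a, ha, b, hb, rfl⟩, y, ht⟩
    obtain ⟨d, hd, a', ha', hda⟩ := A.exists_domVia ha
    obtain ⟨c, hc, b', hb', hcb⟩ := B.exists_domVia hb
    -- An arbitrary `t ∈ (AB)^*` need not factor, but `tdct`, which lies below it, does: `d = aa'd`
    -- gives `(ta)(a'dct)`, with first factor in `B^*` and second in `A^*`.
    refine ⟨t * (d * c) * t, ?_, y, ((hda.mul hcb).trans ht).conj⟩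
    have e : t * (d * c) * t = t * a * (a' * d * c * t) := by
      calc t * (d * c) * t = t * ((a * a' * d) * c) * t := by rw [hda.2.1]
        _ = _ := by simp only [mul_assoc]
    rw [e]
    refine Set.mul_mem_mul (dual_mul_subset h (Set.mul_mem_mul ht' ha))
      (mul_dual_subset h (Set.mul_mem_mul ?_ ht'))
    refine B.rngSet_mul_subset (Set.mul_mem_mul ?_ hc)
    rw [← matches_iff.1 h]
    exact A.mul_mem_srcSet ha' hd
  · refine Set.Subset.trans ?_ (A.prod B h).inv.up_eq.subset
    exact up_mono ((dual_mul_dual _ _).trans (dual_mono hr))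

theorem prod_inv {A B : DirCoset T} (h : A.Matches B) :
    (A.prod B h).inv = B.inv.prod A.inv h.inv := DirCoset.ext (dual_prod h)

/-- In `B^* A^* A B` the middle `A^* A` may be exchanged for `B B^*`, and `(B B^* B)^< = B`. -/
theorem srcSet_prod {A B : DirCoset T} (h : A.Matches B) : (A.prod B h).srcSet = B.srcSet := by
  have hA := A.round
  have hB := B.round
  have hA' := A.round_dual
  have hB' := B.round_dual
  change up T (dual T (up T (A.carrier * B.carrier)) * up T (A.carrier * B.carrier)) = _
  have hAB := subset_up_mul hA hB
  have hBA' := subset_up_mul hB' hA'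
  have hAA := subset_up_mul hA' hA
  have e : up T (dual T A.carrier * A.carrier * B.carrier) = B.carrier := by
    rw [← up_up_mul hAA hB, show up T (dual T A.carrier * A.carrier) = _ from h,
      up_up_mul (subset_up_mul hB hB') hB, B.up_triple]
  rw [dual_prod h, up_up_mul hBA' (up_up hAB).symm.subset, up_mul_up_right hBA' hAB]
  rw [show dual T B.carrier * dual T A.carrier * (A.carrier * B.carrier) =
    dual T B.carrier * (dual T A.carrier * A.carrier * B.carrier) by simp only [mul_assoc],
    ← up_mul_up_right hB' (subset_up_mul hAA hB), e]
  rfl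

theorem rngSet_prod {A B : DirCoset T} (h : A.Matches B) : (A.prod B h).rngSet = A.rngSet := by
  rw [← srcSet_inv, prod_inv, srcSet_prod, srcSet_inv]

/-- The source unit of a directed coset. -/
def source (C : DirCoset T) : DirCoset T := C.inv.prod C C.inv_matches

theorem source_carrier (C : DirCoset T) : C.source.carrier = C.srcSet := rfl

theorem srcSet_source (C : DirCoset T) : C.source.srcSet = C.srcSet := srcSet_prod _

theorem dual_srcSet (C : DirCoset T) : dual T C.srcSet = C.srcSet := by
  have := dual_prod C.inv_matches
  change _ = up T (dual T C.carrier * dual T (dual T C.carrier)) at this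
  rw [C.dual_dual] at this
  exact this

/-- A directed coset that contains an element of `N` is a unit. -/
theorem carrier_eq_srcSet (E : DirCoset T) {n : S} (hn : n ∈ E.carrier) (hnN : n ∈ T.N) :
    E.carrier = E.srcSet := by
  have hN : ∀ {m s n : S}, n ∈ T.N → DomVia T m s n → m ∈ T.N := by
    rintro m s n hn ⟨h1, -, h3, -⟩
    rw [← h1]; exact T.N.mul_mem h3 hn
  have hmns : ∀ {m s n : S}, n ∈ T.N → DomVia T m s n → m * n * s = m := by
    intro m s n hn h
    rw [mul_assoc, T.central _ h.2.2.2.2.1 _ (hN hn h), h.2.1]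
  -- An element `n ∈ N` is its own local inverse: `mns = m` gives `m <_n s`, hence `n ∈ E^*`.
  have hdual : ∀ n ∈ E.carrier, n ∈ T.N → n ∈ dual T E.carrier := by
    intro n hn hnN
    obtain ⟨m, hm, s, -, h⟩ := E.exists_domVia hn
    exact ⟨m, hm, s, DomVia.of_left (hmns hnN h) (T.N.mul_mem (hN hnN h) hnN)
      h.2.2.2.2.2 h.2.2.2.2.1⟩
  obtain ⟨m, hm, s, -, h⟩ := E.exists_domVia hn
  obtain ⟨l, hl, r, -, h'⟩ := E.exists_domVia hm
  have hmN := hN hnN h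
  have hlN := hN hmN h'
  have hw : m * l * n ∈ E.carrier := E.triple_mem hm (hdual l hl hlN) hn
  have e : m * l * n * (s * r) = m * (l * r) := by
    calc m * l * n * (s * r) = m * (l * n * s) * r := by simp only [mul_assoc]
      _ = m * (l * r) := by rw [hmns hnN (h'.trans h)]; simp only [mul_assoc]
  -- Since `m ∈ E^*`, the product `mn` lies in the source of `E`. If it also lies in `E`, the coset
  -- meets its own source and so equals it. Membership holds because `mln ∈ E E^* E` and `mln <_{sr}
  -- mn`.
  have hmn : m * n ∈ E.carrier := by
    refine E.mem_of_dom hw ⟨s * r, DomVia.of_left ?_ ?_ ?_ ?_⟩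
    · calc m * l * n * (s * r) * (m * n) = m * (l * r * m) * n := by
            rw [e]; simp only [mul_assoc]
        _ = m * l * n := by rw [h'.1]
    · rw [e]; exact T.N.mul_mem hmN h'.2.2.1
    · have := (T.binormal m r h'.2.2.2.2.1 h'.2.2.2.2.2 _ h.2.2.2.2.1).1
      simpa only [mul_assoc] using this
    · have := (T.binormal s n h.2.2.2.2.2 h.2.2.2.2.1 _ h'.2.2.2.2.2).1
      simpa only [mul_assoc] using this
  have : E = E.source := eq_of_srcSet_eq E.srcSet_source.symm hmn
    (E.mul_mem_srcSet (hdual m hm hmN) hn)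
  exact congrArg carrier this

/-- If `q <_t p` and the unit `E` contains `tq`, then `(pE)^<` is a directed coset with source `E`
that contains `p`. -/
theorem exists_srcSet_eq (E : DirCoset T) (hE : E.carrier = E.srcSet) {q t p : S}
    (h : DomVia T q t p) (htq : t * q ∈ E.carrier) :
    ∃ B : DirCoset T, p ∈ B.carrier ∧ B.srcSet = E.carrier := by
  have hEd : dual T E.carrier = E.carrier := by rw [hE, dual_srcSet]
  have hEE : E.carrier * E.carrier ⊆ E.carrier := by
    conv_lhs => rw [hE]; rw [← hE]
    have := E.mul_srcSet_subset
    rwa [← hE] at this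
  -- As `q = p(tq)` and `tq ∈ E`, each `qg` with `g ∈ E` stays in `pE`. These elements supply the
  -- lower bounds that make `pE` directed.
  have hptq : p * (t * q) = q := by rw [← mul_assoc, h.2.1]
  have hqX : ∀ e ∈ E.carrier, q * e ∈ {p} * E.carrier := by
    intro e he
    rw [← hptq, mul_assoc]
    exact Set.mul_mem_mul rfl (hEE (Set.mul_mem_mul htq he))
  have hq : q ∈ {p} * E.carrier := hptq ▸ Set.mul_mem_mul rfl htq
  have hdir : IsDirected T ({p} * E.carrier) := by
    rintro _ ⟨x, hx, e, he, rfl⟩ _ ⟨y, hy, f, hf, rfl⟩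
    obtain rfl := Set.mem_singleton_iff.1 hx
    obtain rfl := Set.mem_singleton_iff.1 hy
    obtain ⟨g, hg, hge, hgf⟩ := E.isDirected e he f hf
    exact ⟨q * g, hqX g hg, Dom.mul ⟨t, h⟩ hge, Dom.mul ⟨t, h⟩ hgf⟩
  -- Because `tqt <_p t`, the element `p` belongs to `{tqt}^*`. So `(pE)^* p` lies in the dual of
  -- `tqt pE = tqE ⊆ E`, and `E^* = E`.
  have hXp : dual T ({p} * E.carrier) * {p} ⊆ E.carrier := by
    have hp : p ∈ dual T {t * q * t} := ⟨_, rfl, t, h.conj⟩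
    refine (Set.mul_subset_mul_left (Set.singleton_subset_iff.2 hp)).trans ?_
    refine (dual_mul_dual _ _).trans (Set.Subset.trans (dual_mono ?_) hEd.subset)
    rw [← mul_assoc, Set.singleton_mul_singleton]
    rintro _ ⟨x, hx, e, he, rfl⟩
    change x * e ∈ _
    rw [Set.mem_singleton_iff.1 hx]
    have : t * q * t * (p * e) = t * q * e := by
      calc t * q * t * (p * e) = t * (q * t * p) * e := by simp only [mul_assoc]
        _ = t * q * e := by rw [h.1]
    rw [mul_assoc (t * q * t), this]
    exact hEE (Set.mul_mem_mul htq he)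
  have hX : {p} * E.carrier * dual T ({p} * E.carrier) * ({p} * E.carrier) ⊆ {p} * E.carrier := by
    have e : {p} * E.carrier * dual T ({p} * E.carrier) * ({p} * E.carrier) =
      {p} * (E.carrier * (dual T ({p} * E.carrier) * {p}) * E.carrier) := by
      simp only [mul_assoc]
    rw [e]
    refine Set.mul_subset_mul_left ?_
    refine (Set.mul_subset_mul_right (Set.mul_subset_mul_left hXp)).trans ?_
    exact (Set.mul_subset_mul_right hEE).trans hEE
  let B : DirCoset T :=
    ⟨up T ({p} * E.carrier), ⟨q, hdir.subset_up hq⟩, isCoset_up hdir.subset_up hX, hdir.up⟩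
  have hpB : p ∈ B.carrier := ⟨q, hq, t, h⟩
  refine ⟨B, hpB, Set.Subset.antisymm ?_ ?_⟩
  · refine (up_mono (Set.mul_subset_mul_right (dual_up_subset _))).trans ?_
    have hdd := hdir.dual.subset_up
    change up T (_ * up T _) ⊆ _
    rw [up_mul_up_right (Y := ({p} : Set S) * E.carrier) (up_up hdd).symm.subset hdir.subset_up,
      up_up_mul hdd hdir.subset_up, ← mul_assoc]
    refine (up_mono ((Set.mul_subset_mul_right hXp).trans hEE)).trans E.up_eq.subset
  · have ht : t ∈ dual T B.carrier := ⟨q, hdir.subset_up hq, p, h⟩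
    rw [E.eq_up_singleton_mul_srcSet htq, ← hE]
    refine up_mono ?_ |>.trans B.source.up_eq.subset
    rintro _ ⟨_, rfl, e, he, rfl⟩
    change t * q * e ∈ B.srcSet
    rw [mul_assoc]
    exact B.mul_mem_srcSet ht (hdir.subset_up (hqX e he))

/-- If `Z` is symmetric, a directed coset containing `ab` is the product of directed cosets
containing `a` and `b`. -/
theorem exists_prod_eq (hZ : IsSymmetric (T.Z : Set S)) (D : DirCoset T) {a b : S}
    (hD : a * b ∈ D.carrier) :
    ∃ (A B : DirCoset T) (h : A.Matches B), a ∈ A.carrier ∧ b ∈ B.carrier ∧ D = A.prod B h := by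
  obtain ⟨c, hc, s, hs, h⟩ := D.exists_domVia hD
  obtain ⟨h1, h2, h3, h4, h5, h6⟩ := h
  have hr : ∀ x, c * (s * (a * (b * x))) = c * x := fun x => by
    have : c * (s * (a * (b * x))) = c * s * (a * b) * x := by simp only [mul_assoc]
    rw [this, h1]
  have hr0 : c * (s * (a * b)) = c := by rw [← mul_assoc, h1]
  have hl : ∀ x, a * (b * (s * (c * x))) = c * x := fun x => by
    have : a * (b * (s * (c * x))) = a * b * s * c * x := by simp only [mul_assoc]
    rw [this, h2]
  have z1 : a * b * s * (a * b * s) ∈ T.Z := T.Z.mul_mem h5 h5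
  -- The only use of symmetry of `Z`: it turns `a(bs) ∈ Z` into `bsabsa ∈ Z`, as needed by the three
  -- dominations below.
  have z2 : b * s * a * (b * s) * a ∈ T.Z :=
    hZ a (b * s) (by rw [← mul_assoc]; exact h5)
  have z3 : s * (a * b) * (s * (a * b)) ∈ T.Z := T.Z.mul_mem h6 h6
  have hn : b * s * c * s * a ∈ T.N := by
    have := T.trinormal a (b * s * a * b * s) (c * s) h3 (by simp only [mul_assoc, hl])
      (by simp only [mul_assoc, hr]) (by simpa only [mul_assoc] using z1)
      (by simpa only [mul_assoc] using z2)
    simpa only [mul_assoc, hl] using this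
  have hq : DomVia T (b * s * c * s) (a * b * s * a) (b * s) := by
    refine DomVia.of_left ?_ ?_ ?_ ?_
    · simp only [mul_assoc, hr]
    · simpa only [mul_assoc, hr] using hn
    · simpa only [mul_assoc] using z2
    · simpa only [mul_assoc] using z1
  have hb : DomVia T (b * s * c) (s * a * b * s * a) b := by
    refine DomVia.of_left ?_ ?_ ?_ ?_
    · simp only [mul_assoc, hr, hr0]
    · simpa only [mul_assoc, hr] using hn
    · simpa only [mul_assoc] using z2
    · simpa only [mul_assoc] using z3
  have ha : DomVia T (c * s * a) (b * s * a * b * s) a := by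
    refine DomVia.of_left ?_ ?_ ?_ ?_
    · simp only [mul_assoc, hr]
    · simpa only [mul_assoc, hr] using h3
    · simpa only [mul_assoc] using z1
    · simpa only [mul_assoc] using z2
  -- Some `B'` containing `bs` has the range of `D` as its source. Take `B = B'·D`, which contains
  -- `bsc < b`, and `A = D·B⁻¹`, which contains `csa < a`. Then `A·B` and `D` share their source and
  -- the element `ab`.
  have hE : D.inv.source.carrier = D.rngSet := by rw [source_carrier, srcSet_inv]
  obtain ⟨B', hB', hs'⟩ := exists_srcSet_eq D.inv.source D.inv.srcSet_source.symm hq (by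
    rw [hE]
    simpa only [mul_assoc, hl] using D.mul_mem_rngSet hc hs)
  have hBD : B'.Matches D := by rw [matches_iff, hs', hE]
  have hmem : b * s * c ∈ (B'.prod D hBD).carrier :=
    subset_up_mul B'.round D.round (Set.mul_mem_mul hB' hc)
  have hbB : b ∈ (B'.prod D hBD).carrier := mem_of_dom _ hmem ⟨_, hb⟩
  have hDB : D.Matches (B'.prod D hBD).inv := by rw [matches_iff, rngSet_inv, srcSet_prod]
  have hAB : (D.prod _ hDB).Matches (B'.prod D hBD) := by rw [matches_iff, srcSet_prod, srcSet_inv]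
  have haA : a ∈ (D.prod _ hDB).carrier := by
    refine ⟨_, Set.mul_mem_mul hc ⟨_, hmem, _, hb⟩, b * s * a * b * s, ?_⟩
    simpa only [mul_assoc, hr] using ha
  refine ⟨_, _, hAB, haA, hbB, eq_of_srcSet_eq (x := a * b) ?_ hD ?_⟩
  · rw [srcSet_prod, srcSet_prod]
  · exact subset_up_mul (round _) (round _) (Set.mul_mem_mul haA hbB)

end DirCoset

/-! ### Elementary calculus in groupoids of arrows -/

section

variable {G : Type v} [ArrowOps G]

theorem IsGroupoid.src_inv (hG : IsGroupoid G) (g : G) : src (inv g) = rng g := by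
  rw [src, rng, hG.inv_inv]

theorem IsGroupoid.rng_inv (hG : IsGroupoid G) (g : G) : rng (inv g) = src g := by
  rw [src, rng, hG.inv_inv]

theorem IsGroupoid.composable_inv (hG : IsGroupoid G) (g : G) : Composable g (inv g) :=
  (hG.rng_inv g).symm

theorem IsGroupoid.inv_composable (hG : IsGroupoid G) (g : G) : Composable (inv g) g :=
  hG.src_inv g

theorem IsGroupoid.src_src (hG : IsGroupoid G) (g : G) : src (src g) = src g :=
  hG.src_mul _ _ (hG.inv_composable g)

theorem IsGroupoid.rng_src (hG : IsGroupoid G) (g : G) : rng (src g) = src g :=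
  (hG.rng_mul _ _ (hG.inv_composable g)).trans (hG.rng_inv g)

theorem IsGroupoid.src_rng (hG : IsGroupoid G) (g : G) : src (rng g) = rng g := by
  have h := hG.src_src (inv g)
  rwa [hG.src_inv] at h

theorem IsGroupoid.src_mem_units (hG : IsGroupoid G) (g : G) : src g ∈ units G := by
  have h : Composable (src g) (src g) := (hG.src_src g).trans (hG.rng_src g).symm
  refine ⟨h, ?_⟩
  have := hG.mul_src (src g)
  rwa [hG.src_src] at this

theorem IsGroupoid.rng_mem_units (hG : IsGroupoid G) (g : G) : rng g ∈ units G := by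
  rw [← hG.src_inv]; exact hG.src_mem_units _

theorem IsGroupoid.src_eq_self (hG : IsGroupoid G) {g : G} (h : g ∈ units G) : src g = g := by
  have h1 := hG.assoc (inv g) g g (hG.inv_composable g) h.1
  rw [h.2] at h1
  change mul (src g) g = src g at h1
  rw [show src g = rng g from h.1, hG.rng_mul_self] at h1
  exact (show src g = rng g from h.1).trans h1.symm

theorem IsGroupoid.rng_eq_self (hG : IsGroupoid G) {g : G} (h : g ∈ units G) : rng g = g :=
  h.1.symm.trans (hG.src_eq_self h)

/-- If `gh` is a unit, then `h = g⁻¹`. -/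
theorem IsGroupoid.eq_inv_of_mul_mem_units (hG : IsGroupoid G) {g h : G} (hc : Composable g h)
    (hu : mul g h ∈ units G) : h = inv g := by
  have h1 := hG.assoc (inv g) g h (hG.inv_composable g) hc
  have h2 : mul g h = rng g := by rw [← hG.rng_eq_self hu, hG.rng_mul _ _ hc]
  rw [h2, show mul (inv g) g = rng h from hc, hG.rng_mul_self, ← hG.src_inv, hG.mul_src] at h1
  exact h1

theorem IsGroupoid.mul_left_cancel (hG : IsGroupoid G) {g h k : G} (h1 : Composable g h)
    (h2 : Composable g k) (e : mul g h = mul g k) : h = k := by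
  have key : ∀ h, Composable g h → mul (inv g) (mul g h) = h := by
    intro h hc
    rw [← hG.assoc _ _ _ (hG.inv_composable g) hc, show mul (inv g) g = rng h from hc,
      hG.rng_mul_self]
  rw [← key h h1, e, key k h2]

theorem IsGroupoid.mul_right_cancel (hG : IsGroupoid G) {g h k : G} (h1 : Composable h g)
    (h2 : Composable k g) (e : mul h g = mul k g) : h = k := by
  have key : ∀ h, Composable h g → mul (mul h g) (inv g) = h := by
    intro h hc
    rw [hG.assoc _ _ _ hc (hG.composable_inv g), show mul g (inv g) = src h from hc.symm,
      hG.mul_src]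
  rw [← key h h1, e, key k h2]

end

/-! ### The étale groupoid of directed cosets -/

namespace DirCoset

theorem mul_eq {B C : DirCoset T} (h : B.Matches C) : mul B C = B.prod C h := dif_pos h

theorem src_eq (C : DirCoset T) : src C = C.source := mul_eq C.inv_matches

theorem rng_eq (C : DirCoset T) : rng C = C.inv.source := by
  apply DirCoset.ext
  rw [source_carrier, srcSet_inv]
  exact congrArg carrier (mul_eq C.matches_inv)

theorem composable_iff {B C : DirCoset T} : Composable B C ↔ B.Matches C := by
  rw [Composable, src_eq, rng_eq, matches_iff, DirCoset.ext_iff, source_carrier, source_carrier,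
    srcSet_inv]

theorem src_eq_src_iff {B C : DirCoset T} : src B = src C ↔ B.srcSet = C.srcSet := by
  rw [src_eq, src_eq, DirCoset.ext_iff]; rfl

theorem rng_eq_rng_iff {B C : DirCoset T} : rng B = rng C ↔ B.rngSet = C.rngSet := by
  rw [rng_eq, rng_eq, DirCoset.ext_iff, source_carrier, source_carrier, srcSet_inv, srcSet_inv]

theorem prod_assoc {A B C : DirCoset T} (h : A.Matches B) (h' : B.Matches C)
    (k : (A.prod B h).Matches C) (k' : A.Matches (B.prod C h')) :
    (A.prod B h).prod C k = A.prod (B.prod C h') k' := by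
  apply DirCoset.ext
  change up T (up T (A.carrier * B.carrier) * C.carrier) =
    up T (A.carrier * up T (B.carrier * C.carrier))
  rw [up_up_mul (subset_up_mul A.round B.round) C.round,
    up_mul_up_right A.round (subset_up_mul B.round C.round), mul_assoc]

theorem isGroupoid (T : StructuredSemigroup S) : IsGroupoid (DirCoset T) where
  inv_inv := inv_inv'
  src_mul g h hc := by
    rw [composable_iff] at hc
    rw [mul_eq hc, src_eq_src_iff, srcSet_prod]
  rng_mul g h hc := by
    rw [composable_iff] at hc
    rw [mul_eq hc, rng_eq_rng_iff, rngSet_prod]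
  assoc g h k hc hc' := by
    rw [composable_iff] at hc hc'
    have k1 : (g.prod h hc).Matches k := by rw [matches_iff, srcSet_prod]; exact hc'
    have k2 : g.Matches (h.prod k hc') := by rw [matches_iff, rngSet_prod]; exact hc
    rw [mul_eq hc, mul_eq hc', mul_eq k1, mul_eq k2, prod_assoc]
  mul_src g := by
    have h : g.Matches g.source := by
      rw [matches_iff, source, rngSet_prod, rngSet_inv]
    rw [src_eq, mul_eq h]
    apply DirCoset.ext
    change up T (g.carrier * up T (dual T g.carrier * g.carrier)) = _
    rw [up_mul_up_right g.round (subset_up_mul g.round_dual g.round), ← mul_assoc, g.up_triple]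
  rng_mul_self g := by
    have h : g.inv.source.Matches g := by rw [matches_iff, srcSet_source, srcSet_inv]
    rw [rng_eq, mul_eq h]
    apply DirCoset.ext
    change up T (g.inv.srcSet * g.carrier) = _
    rw [srcSet_inv]
    change up T (up T (g.carrier * dual T g.carrier) * g.carrier) = _
    rw [up_up_mul (subset_up_mul g.round g.round_dual) g.round, g.up_triple]

theorem isOpen_mem (a : S) : IsOpen {D : DirCoset T | a ∈ D.carrier} :=
  TopologicalSpace.isOpen_generateFrom_of_mem ⟨a, rfl⟩

/-- The sets `𝒟_a` form a base, not merely a subbase: if `d ∈ D` lies below `a` and `b`, then `D ∈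
𝒟_d ⊆ 𝒟_a ∩ 𝒟_b`. -/
theorem exists_mem_subset {U : Set (DirCoset T)} (hU : IsOpen U) {D : DirCoset T} (hD : D ∈ U) :
    ∃ a ∈ D.carrier, {E : DirCoset T | a ∈ E.carrier} ⊆ U := by
  induction hU with
  | basic s hs => obtain ⟨a, rfl⟩ := hs; exact ⟨a, hD, subset_rfl⟩
  | univ => exact ⟨_, D.nonempty.some_mem, Set.subset_univ _⟩
  | inter s t _ _ ihs iht =>
    obtain ⟨a, ha, hs⟩ := ihs hD.1
    obtain ⟨b, hb, ht⟩ := iht hD.2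
    obtain ⟨d, hd, hda, hdb⟩ := D.isDirected a ha b hb
    exact ⟨d, hd, fun E hE => ⟨hs (E.mem_of_dom hE hda), ht (E.mem_of_dom hE hdb)⟩⟩
  | sUnion s _ ih =>
    obtain ⟨t, ht, hDt⟩ := hD
    obtain ⟨a, ha, h⟩ := ih t ht hDt
    exact ⟨a, ha, h.trans (Set.subset_sUnion_of_mem ht)⟩

theorem continuous_of_isOpen {X : Type w} [TopologicalSpace X] {f : X → DirCoset T}
    (h : ∀ a : S, IsOpen {x | a ∈ (f x).carrier}) : Continuous f := by
  refine continuous_generateFrom_iff.2 ?_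
  rintro _ ⟨a, rfl⟩
  exact h a

theorem isOpen_mem_dual (a : S) : IsOpen {D : DirCoset T | a ∈ dual T D.carrier} := by
  have : {D : DirCoset T | a ∈ dual T D.carrier} =
      ⋃ (d : S) (_ : ∃ b, DomVia T d a b), {D : DirCoset T | d ∈ D.carrier} := by
    ext D
    simp only [Set.mem_ofPred_eq, Set.mem_iUnion, exists_prop]
    exact ⟨fun ⟨d, hd, b, h⟩ => ⟨d, ⟨b, h⟩, hd⟩, fun ⟨d, ⟨b, h⟩, hd⟩ => ⟨d, hd, b, h⟩⟩
  rw [this]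
  exact isOpen_biUnion fun d _ => isOpen_mem d

theorem isTopologicalGroupoid (T : StructuredSemigroup S) :
    IsTopologicalGroupoid (DirCoset T) where
  groupoid := isGroupoid T
  continuous_inv := continuous_of_isOpen isOpen_mem_dual
  continuousOn_mul := by
    rw [continuousOn_iff_continuous_domRestrict]
    refine continuous_of_isOpen fun a => ?_
    have : {x : {p : DirCoset T × DirCoset T | Composable p.1 p.2} | a ∈ (Set.domRestrict _
          (fun p : DirCoset T × DirCoset T => mul p.1 p.2) x).carrier} =
        ⋃ (b : S) (c : S) (_ : Dom T (b * c) a), {x | b ∈ x.1.1.carrier} ∩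
          {x | c ∈ x.1.2.carrier} := by
      ext ⟨⟨B, C⟩, h⟩
      have h' : B.Matches C := composable_iff.1 h
      simp only [Set.mem_ofPred_eq, Set.mem_iUnion, exists_prop, Set.domRestrict_apply,
        Set.mem_inter_iff]
      rw [mul_eq h']
      constructor
      · rintro ⟨_, ⟨b, hb, c, hc, rfl⟩, hd⟩
        exact ⟨b, c, hd, hb, hc⟩
      · rintro ⟨b, c, hd, hb, hc⟩
        exact ⟨_, ⟨b, hb, c, hc, rfl⟩, hd⟩
    rw [this]
    refine isOpen_iUnion fun b => isOpen_iUnion fun c => isOpen_iUnion fun _ => ?_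
    exact ((isOpen_mem b).preimage (continuous_fst.comp continuous_subtype_val)).inter
      ((isOpen_mem c).preimage (continuous_snd.comp continuous_subtype_val))

theorem isEtaleGroupoid (T : StructuredSemigroup S) : IsEtaleGroupoid (DirCoset T) where
  topological := isTopologicalGroupoid T
  isOpenMap_src := by
    intro U hU
    rw [isOpen_iff_forall_mem_open]
    rintro _ ⟨D, hD, rfl⟩
    obtain ⟨a, ha, haU⟩ := exists_mem_subset hU hD
    obtain ⟨d, hd, s, hs, h⟩ := D.exists_domVia ha
    -- Every `E` containing `sd ∈ N` is a unit, and it is the source of a directed coset containing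
    -- `a`.
    refine ⟨{E | s * d ∈ E.carrier}, ?_, isOpen_mem _, ?_⟩
    · intro E hE
      obtain ⟨B, hB, hBE⟩ := exists_srcSet_eq E (E.carrier_eq_srcSet hE h.2.2.2.1) h hE
      exact ⟨B, haU hB, by rw [src_eq]; exact DirCoset.ext hBE⟩
    · rw [src_eq]
      exact D.mul_mem_srcSet hs hd

theorem isEtaleRepresentation (hZ : IsSymmetric (T.Z : Set S)) :
    IsEtaleRepresentation T (fun a => {D : DirCoset T | a ∈ D.carrier}) where
  etale := isEtaleGroupoid T
  isOpen := isOpen_mem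
  isSlice a := ⟨fun B hB C hC h => eq_of_srcSet_eq (src_eq_src_iff.1 h) hB hC,
    fun B hB C hC h => eq_of_rngSet_eq (rng_eq_rng_iff.1 h) hB hC⟩
  map_mul a b := by
    ext D
    constructor
    · intro hD
      obtain ⟨A, B, h, hA, hB, e⟩ := exists_prod_eq hZ D hD
      exact ⟨A, hA, B, hB, composable_iff.2 h, e.trans (mul_eq h).symm⟩
    · rintro ⟨A, hA, B, hB, h, rfl⟩
      rw [mul_eq (composable_iff.1 h)]
      exact subset_up_mul A.round B.round (Set.mul_mem_mul hA hB)
  cover D := D.nonempty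
  map_N n hn D hD := by
    have : src D = D := by
      rw [src_eq]; exact DirCoset.ext (D.carrier_eq_srcSet hD hn).symm
    rw [← this]
    exact (isGroupoid T).src_mem_units D
  locallyRound D a ha := by
    obtain ⟨d, hd, s, -, h⟩ := D.exists_domVia ha
    exact ⟨d, ⟨s, h⟩, hd⟩

end DirCoset

/-! ### The relation `∼_D` and its compatibility with products and inverses -/

namespace DirCoset

theorem mem_inv_of_domVia {C : DirCoset T} {d c' c : S} (hd : d ∈ C.carrier)
    (h : DomVia T d c' c) : c' ∈ C.inv.carrier := ⟨d, hd, c, h⟩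

theorem mul_mem_prod {A B : DirCoset T} (h : A.Matches B) {a b : S} (ha : a ∈ A.carrier)
    (hb : b ∈ B.carrier) : a * b ∈ (A.prod B h).carrier :=
  subset_up_mul A.round B.round (Set.mul_mem_mul ha hb)

theorem mul_mem_source (C : DirCoset T) {s c : S} (hs : s ∈ C.inv.carrier)
    (hc : c ∈ C.carrier) : s * c ∈ C.source.carrier := C.mul_mem_srcSet hs hc

theorem sim_iff (D : DirCoset T) {a b : S} : Sim T D.carrier a b ↔
    a ∈ D.carrier ∧ b ∈ D.carrier ∧
      ∃ s ∈ dual T D.carrier, ∃ t ∈ dual T D.carrier, s * a * t = s * b * t := by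
  rw [Sim, D.up_eq]

theorem sim_refl (D : DirCoset T) {a : S} (ha : a ∈ D.carrier) : Sim T D.carrier a a := by
  obtain ⟨s, hs⟩ := D.inv.nonempty
  exact D.sim_iff.2 ⟨ha, ha, s, hs, s, hs, rfl⟩

theorem _root_.BundleRep.Sim.symm {A : Set S} {a b : S} (h : Sim T A a b) : Sim T A b a := by
  obtain ⟨ha, hb, s, hs, t, ht, e⟩ := h
  exact ⟨hb, ha, s, hs, t, ht, e.symm⟩

/-- If `r <_x s` and `w <_y t`, then `raw = rx(sat)yw`, so the equality `sat = sbt` is inherited by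
smaller outer factors. Hence witnesses of `∼_D` may be shrunk at will. -/
theorem _root_.BundleRep.Dom.mul_mul_eq {a b r s w t : S} (hr : Dom T r s) (hw : Dom T w t)
    (e : s * a * t = s * b * t) : r * a * w = r * b * w := by
  obtain ⟨x, hx⟩ := hr
  obtain ⟨y, hy⟩ := hw
  have key : ∀ a, r * a * w = r * x * (s * a * t) * y * w := by
    intro a
    calc r * a * w = r * x * s * a * (t * y * w) := by rw [hx.1, hy.2.1]
      _ = _ := by simp only [mul_assoc]
  rw [key, e, ← key]

theorem exists_sim (D : DirCoset T) {a b : S} (h : Sim T D.carrier a b) {p q : S}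
    (hp : p ∈ dual T D.carrier) (hq : q ∈ dual T D.carrier) :
    ∃ s ∈ dual T D.carrier, ∃ t ∈ dual T D.carrier, Dom T s p ∧ Dom T t q ∧
      s * a * t = s * b * t := by
  obtain ⟨-, -, s, hs, t, ht, e⟩ := h
  obtain ⟨s', hs', h1, h2⟩ := D.inv.isDirected s hs p hp
  obtain ⟨t', ht', h3, h4⟩ := D.inv.isDirected t ht q hq
  exact ⟨s', hs', t', ht', h2, h4, h1.mul_mul_eq h3 e⟩

theorem sim_trans (D : DirCoset T) {a b c : S} (h : Sim T D.carrier a b)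
    (h' : Sim T D.carrier b c) : Sim T D.carrier a c := by
  obtain ⟨-, hc, p, hp, q, hq, e⟩ := h'
  obtain ⟨s, hs, t, ht, hsp, htq, e'⟩ := D.exists_sim h hp hq
  exact ⟨h.1, hc, s, hs, t, ht, e'.trans (hsp.mul_mul_eq htq e)⟩

/-- The two factors are changed one at a time. Centrality moves an element of `Z` past the unchanged
factor, to bring the required witness next to the changing one. -/
theorem sim_mul {A B : DirCoset T} (h : A.Matches B) {a a' b b' : S}
    (ha : Sim T A.carrier a a') (hb : Sim T B.carrier b b') :
    Sim T (A.prod B h).carrier (a * b) (a' * b') := by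
  have hdual : ∀ {x y}, x ∈ dual T B.carrier → y ∈ dual T A.carrier →
      x * y ∈ dual T (A.prod B h).carrier := fun hx hy =>
    dual_mono (subset_up_mul A.round B.round) (dual_mul_dual _ _ (Set.mul_mem_mul hx hy))
  obtain ⟨ha1, ha2, s, hs, s', hs', e⟩ := A.sim_iff.1 ha
  obtain ⟨hb1, hb2, t, ht, t', ht', e'⟩ := B.sim_iff.1 hb
  refine sim_trans (b := a' * b) _ ?_ ?_
  · obtain ⟨d, hd, x, hx, hdx⟩ := B.exists_domVia hb1
    obtain ⟨r, hr, y, -, hry⟩ := A.inv.exists_domVia hs'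
    refine (sim_iff _).2 ⟨mul_mem_prod h ha1 hb1, mul_mem_prod h ha2 hb1,
      t * s, hdual ht hs, x * r, hdual hx hr, ?_⟩
    have hc : b * x * (s' * y) = s' * y * (b * x) :=
      (T.central _ hdx.2.2.2.2.1 _ (T.Z_le_N hry.2.2.2.2.1)).symm
    -- Here `s'y` fixes `r` from the left and commutes with `bx`, so `s'` can be placed directly to
    -- the left of `b`; this exposes `sas'` in the product.
    have hbr : b * (x * r) = s' * (y * (b * (x * r))) := by
      calc b * (x * r) = b * x * r := by rw [mul_assoc]
        _ = b * x * (s' * y * r) := by rw [hry.2.1]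
        _ = b * x * (s' * y) * r := by simp only [mul_assoc]
        _ = s' * (y * (b * (x * r))) := by rw [hc]; simp only [mul_assoc]
    calc t * s * (a * b) * (x * r) = t * s * a * (b * (x * r)) := by simp only [mul_assoc]
      _ = t * (s * a * s') * (y * (b * (x * r))) := by
          nth_rw 1 [hbr]; simp only [mul_assoc]
      _ = t * s * a' * (b * (x * r)) := by
          rw [e]; nth_rw 2 [hbr]; simp only [mul_assoc]
      _ = _ := by simp only [mul_assoc]
  · obtain ⟨d, hd, x, hx, hdx⟩ := A.exists_domVia ha2
    obtain ⟨r, hr, y, -, hry⟩ := B.inv.exists_domVia ht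
    refine (sim_iff _).2 ⟨mul_mem_prod h ha2 hb1, mul_mem_prod h ha2 hb2,
      r * x, hdual hr hx, t' * s, hdual ht' hs, ?_⟩
    have hc : x * a' * (y * t) = y * t * (x * a') :=
      (T.central _ hdx.2.2.2.2.2 _ (T.Z_le_N hry.2.2.2.2.2)).symm
    have hra : r * x * a' = r * x * a' * y * t := by
      calc r * x * a' = r * y * t * x * a' := by rw [hry.1]
        _ = r * (y * t * (x * a')) := by simp only [mul_assoc]
        _ = r * x * a' * y * t := by rw [← hc]; simp only [mul_assoc]
    calc r * x * (a' * b) * (t' * s) = r * x * a' * (b * (t' * s)) := by simp only [mul_assoc]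
      _ = r * x * a' * y * (t * b * t') * s := by
          nth_rw 1 [hra]; simp only [mul_assoc]
      _ = r * x * a' * (b' * (t' * s)) := by
          rw [e']; nth_rw 2 [hra]; simp only [mul_assoc]
      _ = _ := by simp only [mul_assoc]

/-- Interpolating `f <_x d <_{c'} c` yields `r = xdc' ∈ C^*` with `r <_c c'`. Being a local inverse
is thus symmetric in `c` and `c'`. -/
theorem exists_dual_domVia (C : DirCoset T) {d c' c : S} (hd : d ∈ C.carrier)
    (h : DomVia T d c' c) : ∃ r ∈ dual T C.carrier, DomVia T r c c' := by
  obtain ⟨f, hf, x, hx, hfx⟩ := C.exists_domVia hd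
  exact ⟨_, ⟨f, hf, c, (hfx.interp h).1⟩, (hfx.interp h).2⟩

/-- The witnesses are `csc` and `ete` in `C^{**} = C`, where `sct = set` with `s <_c c'` and `t <_e
e'`: both products reduce to `c(sct)e = c(set)e`. Taking `e = c` shows that the inverse germ does
not depend on `c'`. -/
theorem sim_inv (C : DirCoset T) {c e c' e' d f : S} (hd : d ∈ C.carrier) (hf : f ∈ C.carrier)
    (hc : DomVia T d c' c) (he : DomVia T f e' e) (h : Sim T C.carrier c e) :
    Sim T (dual T C.carrier) c' e' := by
  obtain ⟨p, hp, hpc⟩ := C.exists_dual_domVia hd hc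
  obtain ⟨q, hq, hqe⟩ := C.exists_dual_domVia hf he
  obtain ⟨s, hs, t, ht, ⟨x, hx⟩, ⟨y, hy⟩, est⟩ := C.exists_sim h hp hq
  have hs' := hx.trans hpc
  have ht' := hy.trans hqe
  obtain ⟨hcC, heC, -⟩ := C.sim_iff.1 h
  have mem : ∀ {x y}, x ∈ C.carrier → y ∈ dual T C.carrier →
      x * y * x ∈ dual T (dual T C.carrier) := by
    intro x y hx hy
    rw [C.dual_dual]; exact C.triple_mem hx hy hx
  refine (C.inv.sim_iff).2 ⟨⟨d, hd, c, hc⟩, ⟨f, hf, e, he⟩, _, mem hcC hs, _, mem heC ht, ?_⟩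
  calc c * s * c * c' * (e * t * e) = c * (s * c * c') * e * t * e := by simp only [mul_assoc]
    _ = c * (s * e * t) * e := by rw [hs'.1]; simp only [mul_assoc]
    _ = c * s * c * (e' * e * t) * e := by rw [← est, ht'.2.1]; simp only [mul_assoc]
    _ = c * s * c * e' * (e * t * e) := by simp only [mul_assoc]

/-- The same `s` and `t` witness the relation at all nearby cosets. All continuity statements about
germs rest on this. -/
theorem isOpen_sim (a b : S) : IsOpen {D : DirCoset T | Sim T D.carrier a b} := by
  have : {D : DirCoset T | Sim T D.carrier a b} =
      {D : DirCoset T | a ∈ D.carrier} ∩ ({D : DirCoset T | b ∈ D.carrier} ∩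
        ⋃ (s : S) (t : S) (_ : s * a * t = s * b * t),
          {D : DirCoset T | s ∈ dual T D.carrier} ∩ {D : DirCoset T | t ∈ dual T D.carrier}) := by
    ext D
    simp only [Set.mem_ofPred_eq, sim_iff, Set.mem_inter_iff, Set.mem_iUnion, exists_prop]
    refine and_congr_right fun _ => and_congr_right fun _ => ?_
    exact ⟨fun ⟨s, hs, t, ht, e⟩ => ⟨s, t, e, hs, ht⟩, fun ⟨s, t, e, hs, ht⟩ => ⟨s, hs, t, ht, e⟩⟩
  rw [this]
  exact (isOpen_mem a).inter ((isOpen_mem b).inter (isOpen_iUnion fun s => isOpen_iUnion fun t =>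
    isOpen_iUnion fun _ => (isOpen_mem_dual s).inter (isOpen_mem_dual t)))

end DirCoset

open DirCoset

/-! ### The topological groupoid of germs `[d, D]` -/

namespace DirGerm

theorem mk'_eq_mk'_iff {A B : DirCoset T} {a b : S} (ha : a ∈ A.carrier) (hb : b ∈ B.carrier) :
    mk' a A ha = mk' b B hb ↔ A = B ∧ Sim T A.carrier a b := by
  constructor
  · intro h
    obtain rfl : A = B := congrArg base h
    refine ⟨rfl, ?_⟩
    have : {x | Sim T A.carrier a x} = {x | Sim T A.carrier b x} := congrArg cls h
    have hb' : b ∈ {x | Sim T A.carrier b x} := A.sim_refl hb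
    rw [← this] at hb'
    exact hb'
  · rintro ⟨rfl, h⟩
    refine DirGerm.ext (Set.ext fun x => ?_) rfl
    exact ⟨fun h' => A.sim_trans h.symm h', fun h' => A.sim_trans h h'⟩

theorem exists_eq_mk' (p : DirGerm T) : ∃ a A ha, p = mk' a A ha :=
  ⟨_, _, _, p.mk_rep.symm⟩

theorem sim_rep {a : S} {A : DirCoset T} (ha : a ∈ A.carrier) :
    Sim T A.carrier (mk' a A ha).rep a :=
  ((mk'_eq_mk'_iff (mk' a A ha).rep_mem ha).1 (mk' a A ha).mk_rep).2

theorem inv_mk' {C : DirCoset T} {c c' d : S} (hc : c ∈ C.carrier) (hd : d ∈ C.carrier)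
    (h : DomVia T d c' c) : inv (mk' c C hc) = mk' c' C.inv (mem_inv_of_domVia hd h) := by
  refine (mk'_eq_mk'_iff _ _).2 ⟨rfl, ?_⟩
  obtain ⟨hd', h'⟩ := (mk' c C hc).exists_inv.choose_spec.choose_spec
  exact C.sim_inv hd' hd h' h (sim_rep hc)

theorem mul_mk' {A B : DirCoset T} (h : A.Matches B) {a b : S} (ha : a ∈ A.carrier)
    (hb : b ∈ B.carrier) : mul (mk' a A ha) (mk' b B hb) =
      mk' (a * b) (A.prod B h) (mul_mem_prod h ha hb) := by
  refine (dif_pos h).trans ((mk'_eq_mk'_iff _ _).2 ⟨rfl, ?_⟩)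
  exact sim_mul h (sim_rep ha) (sim_rep hb)

theorem base_mul {p q : DirGerm T} (h : p.base.Matches q.base) :
    (mul p q).base = mul p.base q.base := by
  rw [DirCoset.mul_eq h]
  exact congrArg base (dif_pos h)

theorem base_src (p : DirGerm T) : (src p).base = src p.base :=
  base_mul p.base.inv_matches

theorem base_rng (p : DirGerm T) : (rng p).base = rng p.base :=
  base_mul p.base.matches_inv

/-- A germ over a unit, represented by an element of `Z` that acts trivially on some member of the
base point. -/
def IsUnitGerm (p : DirGerm T) : Prop :=
  dual T p.base.carrier = p.base.carrier ∧ ∃ z ∈ T.Z, ∃ w ∈ p.base.carrier, w * z = w ∧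
    ∃ hz : z ∈ p.base.carrier, p = mk' z p.base hz

/-- Any `u ∈ D = D^*` below both `w` and `w'` satisfies `uz = u = uz'`, so `uzu = uz'u`. Uniqueness
of the unit germ over a base point reduces composability, and the source and range laws, to the base
groupoid. -/
theorem IsUnitGerm.eq_of_base_eq {p q : DirGerm T} (hp : IsUnitGerm p) (hq : IsUnitGerm q)
    (h : p.base = q.base) : p = q := by
  obtain ⟨cp, D, hD⟩ := p
  obtain ⟨cq, E, hE⟩ := q
  obtain rfl : D = E := h
  obtain ⟨hd, z, -, w, hw, hwz, hz, e⟩ := hp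
  obtain ⟨-, z', -, w', hw', hwz', hz', e'⟩ := hq
  rw [e, e']
  refine (mk'_eq_mk'_iff _ _).2 ⟨rfl, (sim_iff _).2 ⟨hz, hz', ?_⟩⟩
  obtain ⟨u, hu, ⟨x, hx⟩, ⟨y, hy⟩⟩ := D.isDirected w hw w' hw'
  have hu' : u ∈ dual T D.carrier := hd.symm ▸ hu
  refine ⟨u, hu', u, hu', ?_⟩
  have e1 : u * z = u := by rw [← hx.1, mul_assoc, hwz]
  have e2 : u * z' = u := by rw [← hy.1, mul_assoc, hwz']
  rw [e1, e2]

theorem src_mk' {C : DirCoset T} {c c' d : S} (hc : c ∈ C.carrier) (hd : d ∈ C.carrier)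
    (h : DomVia T d c' c) :
    src (mk' c C hc) =
      mk' (c' * c) C.source (C.mul_mem_source (mem_inv_of_domVia hd h) hc) := by
  rw [src, inv_mk' hc hd h]
  exact mul_mk' C.inv_matches _ _

theorem rng_mk' {C : DirCoset T} {c c' d : S} (hc : c ∈ C.carrier) (hd : d ∈ C.carrier)
    (h : DomVia T d c' c) : rng (mk' c C hc) =
      mk' (c * c') (C.prod C.inv C.matches_inv)
        (mul_mem_prod C.matches_inv hc (mem_inv_of_domVia hd h)) := by
  rw [rng, inv_mk' hc hd h]
  exact mul_mk' C.matches_inv _ _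

theorem isUnitGerm_src (p : DirGerm T) : IsUnitGerm (src p) := by
  obtain ⟨c, C, hc, rfl⟩ := p.exists_eq_mk'
  obtain ⟨d, hd, c', hc', h⟩ := C.exists_domVia hc
  rw [src_mk' hc hd h]
  refine ⟨C.dual_srcSet, _, h.2.2.2.2.2, c' * d, C.mul_mem_srcSet hc' hd, ?_, _, rfl⟩
  rw [mul_assoc, ← mul_assoc d, h.1]

theorem isUnitGerm_rng (p : DirGerm T) : IsUnitGerm (rng p) := by
  obtain ⟨c, C, hc, rfl⟩ := p.exists_eq_mk'
  obtain ⟨d, hd, c', hc', h⟩ := C.exists_domVia hc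
  rw [rng_mk' hc hd h]
  refine ⟨?_, _, h.2.2.2.2.1, d * c', C.mul_mem_rngSet hd hc', ?_, _, rfl⟩
  · have := C.inv.dual_srcSet
    rwa [srcSet_inv] at this
  · calc d * c' * (c * c') = d * c' * c * c' := by simp only [mul_assoc]
      _ = d * c' := by rw [h.1]

theorem composable_iff {p q : DirGerm T} : Composable p q ↔ p.base.Matches q.base := by
  rw [← DirCoset.composable_iff, Composable, Composable, ← base_src, ← base_rng]
  exact ⟨congrArg base, (isUnitGerm_src p).eq_of_base_eq (isUnitGerm_rng q)⟩

theorem sim_mul_mul {C : DirCoset T} {c c' d : S} (hc : c ∈ C.carrier) (hd : d ∈ C.carrier)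
    (h : DomVia T d c' c) : Sim T C.carrier (c * c' * c) c := by
  obtain ⟨r, hr, h'⟩ := C.exists_dual_domVia hd h
  refine C.sim_iff.2 ⟨C.triple_mem hc (mem_inv_of_domVia hd h) hc, hc, r, hr, r, hr, ?_⟩
  rw [← mul_assoc, ← mul_assoc, h'.1]

theorem isGroupoid (T : StructuredSemigroup S) : IsGroupoid (DirGerm T) where
  inv_inv p := by
    obtain ⟨c, C, hc, rfl⟩ := p.exists_eq_mk'
    obtain ⟨d, hd, c', hc', h⟩ := C.exists_domVia hc
    obtain ⟨r, hr, h'⟩ := C.exists_dual_domVia hd h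
    rw [inv_mk' hc hd h, inv_mk' (C := C.inv) _ hr h', mk'_eq_mk'_iff]
    refine ⟨C.inv_inv', ?_⟩
    rw [C.inv_inv']
    exact C.sim_refl hc
  src_mul p q h := by
    rw [composable_iff] at h
    refine (isUnitGerm_src _).eq_of_base_eq (isUnitGerm_src _) ?_
    rw [base_src, base_src, base_mul h]
    exact (DirCoset.isGroupoid T).src_mul _ _ (DirCoset.composable_iff.2 h)
  rng_mul p q h := by
    rw [composable_iff] at h
    refine (isUnitGerm_rng _).eq_of_base_eq (isUnitGerm_rng _) ?_
    rw [base_rng, base_rng, base_mul h]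
    exact (DirCoset.isGroupoid T).rng_mul _ _ (DirCoset.composable_iff.2 h)
  assoc p q r h h' := by
    rw [composable_iff] at h h'
    obtain ⟨a, A, ha, rfl⟩ := p.exists_eq_mk'
    obtain ⟨b, B, hb, rfl⟩ := q.exists_eq_mk'
    obtain ⟨c, C, hc, rfl⟩ := r.exists_eq_mk'
    change A.Matches B at h
    change B.Matches C at h'
    have k1 : (A.prod B h).Matches C := by rw [matches_iff, srcSet_prod]; exact h'
    have k2 : A.Matches (B.prod C h') := by rw [matches_iff, rngSet_prod]; exact h
    rw [mul_mk' h, mul_mk' h', mul_mk' k1, mul_mk' k2, mk'_eq_mk'_iff]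
    refine ⟨prod_assoc h h' k1 k2, ?_⟩
    rw [mul_assoc]
    refine sim_refl _ ?_
    rw [← mul_assoc]
    exact mul_mem_prod k1 (mul_mem_prod h ha hb) hc
  mul_src p := by
    obtain ⟨c, C, hc, rfl⟩ := p.exists_eq_mk'
    obtain ⟨d, hd, c', hc', h⟩ := C.exists_domVia hc
    have hG := DirCoset.isGroupoid T
    have hm : C.Matches C.source := by
      rw [← DirCoset.composable_iff, ← C.src_eq]; exact (hG.rng_src C).symm
    have e : C.prod C.source hm = C := by
      rw [← mul_eq hm, ← C.src_eq]; exact hG.mul_src C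
    rw [src_mk' hc hd h, mul_mk' hm, mk'_eq_mk'_iff, e]
    exact ⟨rfl, by simpa only [mul_assoc] using sim_mul_mul hc hd h⟩
  rng_mul_self p := by
    obtain ⟨c, C, hc, rfl⟩ := p.exists_eq_mk'
    obtain ⟨d, hd, c', hc', h⟩ := C.exists_domVia hc
    have hG := DirCoset.isGroupoid T
    have hr : rng C = C.prod C.inv C.matches_inv := mul_eq C.matches_inv
    have hm : (C.prod C.inv C.matches_inv).Matches C := by
      rw [← DirCoset.composable_iff, ← hr]; exact hG.src_rng C
    have e : (C.prod C.inv C.matches_inv).prod C hm = C := by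
      rw [← mul_eq hm, ← hr]; exact hG.rng_mul_self C
    rw [rng_mk' hc hd h, mul_mk' hm, mk'_eq_mk'_iff, e]
    exact ⟨rfl, sim_mul_mul hc hd h⟩

/-- This set is both the preimage of `W` under `ã` and a subset of the projection of `W`, so it
serves for continuity of the sections and for openness of the bundle map. -/
theorem isOpen_mk'_mem {W : Set (DirGerm T)} (hW : IsOpen W) (a : S) :
    IsOpen {D : DirCoset T | ∃ h : a ∈ D.carrier, mk' a D h ∈ W} := by
  induction hW with
  | basic s hs =>
    obtain ⟨b, rfl⟩ | ⟨b, rfl⟩ := hs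
    · convert isOpen_sim (T := T) a b using 1
      ext D
      refine ⟨fun ⟨h, h', e⟩ => ((mk'_eq_mk'_iff h h').1 e).2, fun h => ?_⟩
      have h' := D.sim_iff.1 h
      exact ⟨h'.1, h'.2.1, (mk'_eq_mk'_iff _ _).2 ⟨rfl, h⟩⟩
    · convert (isOpen_mem (T := T) a).inter (isOpen_mem b) using 1
      ext D
      exact ⟨fun ⟨h, h'⟩ => ⟨h, h'⟩, fun ⟨h, h'⟩ => ⟨h, h'⟩⟩
  | univ =>
    convert isOpen_mem (T := T) a using 1
    ext D
    exact ⟨fun ⟨h, _⟩ => h, fun h => ⟨h, trivial⟩⟩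
  | inter s t _ _ hs ht =>
    convert hs.inter ht using 1
    ext D
    exact ⟨fun ⟨h, h1, h2⟩ => ⟨⟨h, h1⟩, ⟨h, h2⟩⟩, fun ⟨⟨h, h1⟩, ⟨_, h2⟩⟩ => ⟨h, h1, h2⟩⟩
  | sUnion s _ ih =>
    convert isOpen_biUnion ih using 1
    ext D
    simp only [Set.mem_ofPred_eq, Set.mem_sUnion, Set.mem_iUnion, exists_prop]
    exact ⟨fun ⟨h, t, ht, h1⟩ => ⟨t, ht, h, h1⟩, fun ⟨t, ht, h, h1⟩ => ⟨h, t, ht, h1⟩⟩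

theorem isOpen_base_mem (a : S) : IsOpen {p : DirGerm T | a ∈ p.base.carrier} :=
  TopologicalSpace.isOpen_generateFrom_of_mem (Or.inr ⟨a, rfl⟩)

theorem isOpen_range_mk' (a : S) :
    IsOpen {p : DirGerm T | ∃ h : a ∈ p.base.carrier, p = mk' a p.base h} :=
  TopologicalSpace.isOpen_generateFrom_of_mem (Or.inl ⟨a, rfl⟩)

theorem continuous_base : Continuous (base : DirGerm T → DirCoset T) :=
  continuous_of_isOpen isOpen_base_mem

theorem isTopologicalGroupoid (T : StructuredSemigroup S) :
    IsTopologicalGroupoid (DirGerm T) where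
  groupoid := isGroupoid T
  continuous_inv := by
    have hb : Continuous fun p : DirGerm T => p.base.inv :=
      (DirCoset.isTopologicalGroupoid T).continuous_inv.comp continuous_base
    rw [continuous_iff_continuousAt]
    intro p
    refine TopologicalSpace.tendsto_nhds_generateFrom_iff.2 ?_
    rintro _ (⟨s, rfl⟩ | ⟨s, rfl⟩) hp
    · obtain ⟨c, C, hc, rfl⟩ := p.exists_eq_mk'
      obtain ⟨d, hd, c', hc', h⟩ := C.exists_domVia hc
      rw [inv_mk' hc hd h] at hp
      obtain ⟨hs, e⟩ := hp
      have hsim := ((mk'_eq_mk'_iff _ _).1 e).2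
      -- Near `p` the germ is still that of `c`, the coset still contains `d`, so `c'` still
      -- represents the inverse, and `c' ∼ s` persists in the dual coset.
      filter_upwards [(isOpen_range_mk' c).mem_nhds ⟨hc, rfl⟩,
        (isOpen_base_mem d).mem_nhds (x := mk' c C hc) hd,
        ((isOpen_sim c' s).preimage hb).mem_nhds (x := mk' c C hc) hsim]
      rintro q ⟨hq, e⟩ hdq hsq
      rw [Set.mem_preimage, e, inv_mk' hq hdq h]
      exact ⟨((sim_iff _).1 hsq).2.1, (mk'_eq_mk'_iff _ _).2 ⟨rfl, hsq⟩⟩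
    · exact ((isOpen_mem s).preimage hb).mem_nhds hp
  continuousOn_mul := by
    have hb : ContinuousOn (fun x : DirGerm T × DirGerm T => mul x.1.base x.2.base)
        {x | Composable x.1 x.2} := by
      refine (DirCoset.isTopologicalGroupoid T).continuousOn_mul.comp
        (f := fun x : DirGerm T × DirGerm T => (x.1.base, x.2.base)) ?_ ?_
      · exact ((continuous_base.comp continuous_fst).prodMk
          (continuous_base.comp continuous_snd)).continuousOn
      · exact fun x hx => DirCoset.composable_iff.2 (composable_iff.1 hx)
    rintro ⟨p, q⟩ hpq
    refine TopologicalSpace.tendsto_nhds_generateFrom_iff.2 ?_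
    have hm := composable_iff.1 hpq
    rintro _ (⟨s, rfl⟩ | ⟨s, rfl⟩) hp
    · obtain ⟨a, A, ha, rfl⟩ := p.exists_eq_mk'
      obtain ⟨b, B, hb', rfl⟩ := q.exists_eq_mk'
      change A.Matches B at hm
      replace hp : mul (mk' a A ha) (mk' b B hb') ∈
        {p : DirGerm T | ∃ h : s ∈ p.base.carrier, p = mk' s p.base h} := hp
      rw [mul_mk' hm] at hp
      obtain ⟨hs, e⟩ := hp
      have hsim : Sim T (mul A B).carrier (a * b) s := by
        rw [DirCoset.mul_eq hm]
        exact ((mk'_eq_mk'_iff _ _).1 e).2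
      filter_upwards [self_mem_nhdsWithin,
        mem_nhdsWithin_of_mem_nhds (((isOpen_range_mk' a).preimage continuous_fst).mem_nhds
          (x := (mk' a A ha, mk' b B hb')) ⟨ha, rfl⟩),
        mem_nhdsWithin_of_mem_nhds (((isOpen_range_mk' b).preimage continuous_snd).mem_nhds
          (x := (mk' a A ha, mk' b B hb')) ⟨hb', rfl⟩),
        hb _ hpq ((isOpen_sim (a * b) s).mem_nhds hsim)]
      rintro ⟨p, q⟩ hc ⟨hp, ep⟩ ⟨hq, eq⟩ hsim
      have hc := composable_iff.1 hc
      change Sim T (mul p.base q.base).carrier _ _ at hsim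
      rw [DirCoset.mul_eq hc] at hsim
      change p = _ at ep
      change q = _ at eq
      rw [Set.mem_preimage, ep, eq, mul_mk' hc]
      exact ⟨((sim_iff _).1 hsim).2.1, (mk'_eq_mk'_iff _ _).2 ⟨rfl, hsim⟩⟩
    · have : s ∈ (mul p.base q.base).carrier := by rw [← base_mul hm]; exact hp
      filter_upwards [self_mem_nhdsWithin, hb _ hpq ((isOpen_mem s).mem_nhds this)]
      rintro ⟨p, q⟩ hc hs
      change s ∈ (mul p q).base.carrier
      rw [base_mul (composable_iff.1 hc)]
      exact hs

end DirGerm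

/-! ### The directed coset bundle and its representation -/

theorem isGroupoidBundle_dirCosetBundle (T : StructuredSemigroup S) :
    IsGroupoidBundle (dirCosetBundle T) where
  total := DirGerm.isTopologicalGroupoid T
  base := DirCoset.isEtaleGroupoid T
  map_composable _ _ h := DirCoset.composable_iff.2 (DirGerm.composable_iff.1 h)
  map_mul _ _ h := DirGerm.base_mul (DirGerm.composable_iff.1 h)
  injOn_units p hp q hq h := by
    rw [← (DirGerm.isGroupoid T).src_eq_self hp, ← (DirGerm.isGroupoid T).src_eq_self hq]
    refine (DirGerm.isUnitGerm_src p).eq_of_base_eq (DirGerm.isUnitGerm_src q) ?_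
    rw [DirGerm.base_src, DirGerm.base_src]
    exact congrArg src h
  continuous := DirGerm.continuous_base
  isOpenMap W hW := by
    rw [isOpen_iff_forall_mem_open]
    rintro _ ⟨p, hp, rfl⟩
    obtain ⟨a, A, ha, rfl⟩ := p.exists_eq_mk'
    refine ⟨_, ?_, DirGerm.isOpen_mk'_mem hW a, ⟨ha, hp⟩⟩
    rintro D ⟨h, hD⟩
    exact ⟨_, hD, rfl⟩

theorem isBundleRepresentation_dirCosetRep (hZ : IsSymmetric (T.Z : Set S)) :
    IsBundleRepresentation T (dirCosetBundle T) (dirCosetRep T) where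
  bundle := isGroupoidBundle_dirCosetBundle T
  isSliceSection a :=
    { isOpen_dom := isOpen_mem a
      isSlice_dom := (DirCoset.isEtaleRepresentation hZ).isSlice a
      continuous := by
        refine continuous_def.2 fun W hW => ?_
        refine isOpen_induced_iff.2 ⟨_, DirGerm.isOpen_mk'_mem hW a, ?_⟩
        ext ⟨D, hD⟩
        exact ⟨fun ⟨_, h⟩ => h, fun h => ⟨hD, h⟩⟩
      section_eq := by
        rintro D _ ⟨h, rfl⟩
        rfl }
  map_mul a b D p := by
    constructor
    · rintro ⟨hD, rfl⟩
      obtain ⟨A, B, h, ha, hb, rfl⟩ := exists_prod_eq hZ D hD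
      exact ⟨A, B, _, _, DirCoset.composable_iff.2 h, ⟨ha, rfl⟩, ⟨hb, rfl⟩,
        (DirCoset.mul_eq h).symm, (DirGerm.mul_mk' h ha hb).symm⟩
    · rintro ⟨A, B, _, _, h, ⟨ha, rfl⟩, ⟨hb, rfl⟩, rfl, rfl⟩
      have h := DirCoset.composable_iff.1 h
      rw [DirCoset.mul_eq h]
      exact ⟨mul_mem_prod h ha hb, (DirGerm.mul_mk' h ha hb).symm⟩
  etale_dom := DirCoset.isEtaleRepresentation hZ

/-! ### Transport of groupoids, bundles and representations to larger universes -/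

section ULift

variable {F : Type v} {G : Type w} [ArrowOps F] [ArrowOps G]

instance : ArrowOps (ULift.{w'} G) where
  inv g := ⟨inv g.down⟩
  mul g h := ⟨mul g.down h.down⟩

theorem ULift.composable_iff {g h : ULift.{w'} G} : Composable g h ↔ Composable g.down h.down :=
  ULift.up_inj

theorem ULift.mem_units_iff {g : ULift.{w'} G} : g ∈ units (ULift.{w'} G) ↔ g.down ∈ units G :=
  and_congr ULift.composable_iff ULift.ext_iff

theorem IsGroupoid.ulift (h : IsGroupoid G) : IsGroupoid (ULift.{w'} G) where
  inv_inv _ := ULift.ext _ _ (h.inv_inv _)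
  src_mul _ _ hc := ULift.ext _ _ (h.src_mul _ _ (ULift.composable_iff.1 hc))
  rng_mul _ _ hc := ULift.ext _ _ (h.rng_mul _ _ (ULift.composable_iff.1 hc))
  assoc _ _ _ hc hc' :=
    ULift.ext _ _ (h.assoc _ _ _ (ULift.composable_iff.1 hc) (ULift.composable_iff.1 hc'))
  mul_src _ := ULift.ext _ _ (h.mul_src _)
  rng_mul_self _ := ULift.ext _ _ (h.rng_mul_self _)

theorem IsSlice.ulift {B : Set G} (h : IsSlice B) : IsSlice (ULift.down.{w'} ⁻¹' B) :=
  ⟨fun _ hg _ hk e => ULift.ext _ _ (h.1 hg hk (ULift.up_inj.1 e)),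
    fun _ hg _ hk e => ULift.ext _ _ (h.2 hg hk (ULift.up_inj.1 e))⟩

variable [TopologicalSpace F] [TopologicalSpace G]

theorem IsTopologicalGroupoid.ulift (h : IsTopologicalGroupoid G) :
    IsTopologicalGroupoid (ULift.{w'} G) where
  groupoid := h.groupoid.ulift
  continuous_inv := continuous_uliftUp.comp (h.continuous_inv.comp continuous_uliftDown)
  continuousOn_mul := by
    refine continuous_uliftUp.comp_continuousOn (h.continuousOn_mul.comp
      (f := fun x : ULift.{w'} G × ULift.{w'} G => (x.1.down, x.2.down)) ?_ ?_)
    · exact ((continuous_uliftDown.comp continuous_fst).prodMk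
        (continuous_uliftDown.comp continuous_snd)).continuousOn
    · exact fun x hx => ULift.composable_iff.1 hx

theorem IsEtaleGroupoid.ulift (h : IsEtaleGroupoid G) : IsEtaleGroupoid (ULift.{w'} G) where
  topological := h.topological.ulift
  isOpenMap_src := Homeomorph.ulift.symm.isOpenMap.comp
    (h.isOpenMap_src.comp Homeomorph.ulift.isOpenMap)

theorem IsGroupoidBundle.ulift {π : F → G} (h : IsGroupoidBundle π) :
    IsGroupoidBundle (fun x : ULift.{v'} F => (ULift.up (π x.down) : ULift.{w'} G)) where
  total := h.total.ulift
  base := h.base.ulift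
  map_composable _ _ hc :=
    ULift.composable_iff.2 (h.map_composable _ _ (ULift.composable_iff.1 hc))
  map_mul _ _ hc := ULift.ext _ _ (h.map_mul _ _ (ULift.composable_iff.1 hc))
  injOn_units _ he _ hf hef := ULift.ext _ _
    (h.injOn_units (ULift.mem_units_iff.1 he) (ULift.mem_units_iff.1 hf) (ULift.up_inj.1 hef))
  continuous := continuous_uliftUp.comp (h.continuous.comp continuous_uliftDown)
  isOpenMap := Homeomorph.ulift.symm.isOpenMap.comp
    (h.isOpenMap.comp Homeomorph.ulift.isOpenMap)

theorem IsEtaleRepresentation.ulift {θ : S → Set G} (h : IsEtaleRepresentation T θ) :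
    IsEtaleRepresentation T (fun a => ULift.down.{w'} ⁻¹' θ a) where
  etale := h.etale.ulift
  isOpen a := (h.isOpen a).preimage continuous_uliftDown
  isSlice a := (h.isSlice a).ulift
  map_mul a b := by
    ext k
    rw [Set.mem_preimage, h.map_mul]
    constructor
    · rintro ⟨g, hg, h, hh, hc, e⟩
      exact ⟨⟨g⟩, hg, ⟨h⟩, hh, ULift.composable_iff.2 hc, ULift.ext _ _ e⟩
    · rintro ⟨g, hg, h, hh, hc, e⟩
      exact ⟨g.down, hg, h.down, hh, ULift.composable_iff.1 hc, congrArg ULift.down e⟩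
  cover g := h.cover g.down
  map_N n hn g hg := ULift.mem_units_iff.2 (h.map_N n hn hg)
  locallyRound g a hg := h.locallyRound g.down a hg

theorem IsBundleRepresentation.ulift {π : F → G} {θ : S → (G →. F)}
    (h : IsBundleRepresentation T π θ) :
    IsBundleRepresentation T (fun x : ULift.{v'} F => (ULift.up (π x.down) : ULift.{w'} G))
      (fun a g => (θ a g.down).map ULift.up) where
  bundle := h.bundle.ulift
  isSliceSection a :=
    { isOpen_dom := (h.isSliceSection a).isOpen_dom.preimage continuous_uliftDown
      isSlice_dom := (h.isSliceSection a).isSlice_dom.ulift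
      continuous := continuous_uliftUp.comp ((h.isSliceSection a).continuous.comp
        (Continuous.subtype_mk (continuous_uliftDown.comp continuous_subtype_val) fun x => x.2))
      section_eq := by
        intro g f hf
        obtain ⟨x, hx, rfl⟩ := (Part.mem_map_iff _).1 hf
        exact ULift.ext _ _ ((h.isSliceSection a).section_eq _ _ hx) }
  map_mul a b k f := by
    rw [Part.mem_map_iff]
    constructor
    · rintro ⟨f, hf, rfl⟩
      obtain ⟨g, l, x, y, hc, hx, hy, e, rfl⟩ := (h.map_mul a b _ _).1 hf
      exact ⟨⟨g⟩, ⟨l⟩, ⟨x⟩, ⟨y⟩, ULift.composable_iff.2 hc, (Part.mem_map_iff _).2 ⟨x, hx, rfl⟩,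
        (Part.mem_map_iff _).2 ⟨y, hy, rfl⟩, ULift.ext _ _ e, rfl⟩
    · rintro ⟨g, l, _, _, hc, hx, hy, rfl, rfl⟩
      obtain ⟨x, hx', rfl⟩ := (Part.mem_map_iff _).1 hx
      obtain ⟨y, hy', rfl⟩ := (Part.mem_map_iff _).1 hy
      exact ⟨_, (h.map_mul a b _ _).2
        ⟨_, _, x, y, ULift.composable_iff.1 hc, hx', hy', rfl, rfl⟩, rfl⟩
  etale_dom := h.etale_dom.ulift

end ULift

/-! ### Directed cosets attached to points of an étale representation -/

/-- Every non-empty directed set in an up-closed set `P` with `P P^* P ⊆ P` is contained in some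
directed coset in `P`. -/
theorem exists_dirCoset_subset {X P : Set S} (hX : IsDirected T X) (hne : X.Nonempty)
    (hup : up T P ⊆ P) (hP : P * dual T P * P ⊆ P) (hXP : X ⊆ P) :
    ∃ D : DirCoset T, X ⊆ D.carrier ∧ D.carrier ⊆ P := by
  -- Iterating `Y ↦ Y Y^* Y` preserves directedness and stays inside `P`. The up-closures increase,
  -- and their union is the coset sought.
  let Y : ℕ → Set S := fun n => (fun Y => Y * dual T Y * Y)^[n] X
  have hY : ∀ n, Y (n + 1) = Y n * dual T (Y n) * Y n :=
    fun n => Function.iterate_succ_apply' _ _ _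
  have hdir : ∀ n, IsDirected T (Y n) := by
    intro n
    induction n with
    | zero => exact hX
    | succ n ih => rw [hY]; exact (ih.mul ih.dual).mul ih
  have hYP : ∀ n, Y n ⊆ P := by
    intro n
    induction n with
    | zero => exact hXP
    | succ n ih =>
      rw [hY]
      exact (Set.mul_subset_mul (Set.mul_subset_mul ih (dual_mono ih)) ih).trans hP
  have hmono : Monotone fun n => up T (Y n) := by
    refine monotone_nat_of_le_succ fun n => ?_
    have h1 : Y n ⊆ up T (Y (n + 1)) := by rw [hY]; exact subset_up_triple (hdir n)
    exact (up_mono h1).trans (up_up (hdir (n + 1)).subset_up).subset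
  have hXC : X ⊆ ⋃ n, up T (Y n) := hX.subset_up.trans (Set.subset_iUnion (fun n => up T (Y n)) 0)
  refine ⟨⟨⋃ n, up T (Y n), hne.mono hXC, ⟨?_, ?_⟩, ?_⟩, hXC, ?_⟩
  · rintro _ ⟨_, ⟨a, ha, s, hs, rfl⟩, b, hb, rfl⟩
    obtain ⟨i, ha⟩ := Set.mem_iUnion.1 ha
    obtain ⟨c, hc, d, hs⟩ := hs
    obtain ⟨j, hc⟩ := Set.mem_iUnion.1 hc
    obtain ⟨k, hb⟩ := Set.mem_iUnion.1 hb
    let m := max i (max j k)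
    refine Set.mem_iUnion.2 ⟨m + 1, ?_⟩
    have ha := hmono (le_max_left i (max j k)) ha
    have hc := hmono ((le_max_left j k).trans (le_max_right i _)) hc
    have hb := hmono ((le_max_right j k).trans (le_max_right i _)) hb
    have hs : s ∈ up T (dual T (Y m)) := dual_up_subset _ ⟨c, hc, d, hs⟩
    rw [hY]
    exact up_mul_up _ _ (Set.mul_mem_mul (up_mul_up _ _ (Set.mul_mem_mul ha hs)) hb)
  · apply Set.Subset.antisymm
    · refine Set.iUnion_subset fun n => ?_
      rw [← up_up (hdir n).subset_up]
      exact up_mono (Set.subset_iUnion (fun n => up T (Y n)) n)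
    · rintro b ⟨a, ha, hab⟩
      obtain ⟨n, ha⟩ := Set.mem_iUnion.1 ha
      refine Set.mem_iUnion.2 ⟨n, ?_⟩
      rw [← up_up (hdir n).subset_up]
      exact ⟨a, ha, hab⟩
  · intro a ha b hb
    obtain ⟨i, ha⟩ := Set.mem_iUnion.1 ha
    obtain ⟨j, hb⟩ := Set.mem_iUnion.1 hb
    obtain ⟨d, hd, h⟩ := (hdir (max i j)).up a (hmono (le_max_left i j) ha) b
      (hmono (le_max_right i j) hb)
    exact ⟨d, Set.mem_iUnion.2 ⟨_, hd⟩, h⟩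
  · exact Set.iUnion_subset fun n => (up_mono (hYP n)).trans hup

namespace IsEtaleRepresentation

variable {G : Type w} [ArrowOps G] [TopologicalSpace G] {θ : S → Set G}

/-- Since `c = csb`, write `g = (xy)z` along `θ(c) θ(s) θ(b)`. As `cs ∈ N`, the arrow `xy` is a
unit, so `z = g` and `y = x⁻¹`; `x` and `g` have the same range in the slice `θ(c)`, so `x = g`. -/
theorem mem_of_domVia (hθ : IsEtaleRepresentation T θ) {c s b : S} (h : DomVia T c s b) {g : G}
    (hg : g ∈ θ c) : inv g ∈ θ s ∧ g ∈ θ b := by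
  have hG := hθ.etale.topological.groupoid
  have hg' := hg
  rw [← h.1, hθ.map_mul] at hg'
  obtain ⟨k, hk, z, hz, hkz, rfl⟩ := hg'
  have hu := hθ.map_N _ h.2.2.1 hk
  rw [hθ.map_mul] at hk
  obtain ⟨x, hx, y, hy, hxy, rfl⟩ := hk
  have hz' : mul (mul x y) z = z := by
    rw [← hG.src_eq_self hu, show src (mul x y) = rng z from hkz, hG.rng_mul_self]
  rw [hz'] at hg ⊢
  have hxz : x = z := by
    refine (hθ.isSlice c).2 hx hg ?_
    rw [← show src (mul x y) = rng z from hkz, hG.src_eq_self hu, ← hG.rng_mul _ _ hxy,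
      hG.rng_eq_self hu]
  rw [← hxz, ← hG.eq_inv_of_mul_mem_units hxy hu]
  exact ⟨hy, hxz ▸ hz⟩

/-- Every `a` with `g ∈ θ(a)` lies in a directed coset all of whose members `c` satisfy
`g ∈ θ(c)`. -/
theorem exists_dirCoset (hθ : IsEtaleRepresentation T θ) {g : G} {a : S} (ha : g ∈ θ a) :
    ∃ D : DirCoset T, a ∈ D.carrier ∧ ∀ c ∈ D.carrier, g ∈ θ c := by
  have hG := hθ.etale.topological.groupoid
  choose f hf hfθ using fun c : {c : S // g ∈ θ c} => hθ.locallyRound g c c.2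
  let x : ℕ → {c : S // g ∈ θ c} := fun n => (fun c => ⟨f c, hfθ c⟩)^[n] ⟨a, ha⟩
  have hx : ∀ n, Dom T (x (n + 1)) (x n) := by
    intro n
    have : x (n + 1) = ⟨f (x n), hfθ (x n)⟩ := Function.iterate_succ_apply' _ _ _
    rw [this]; exact hf _
  have hlt : ∀ m k, Dom T (x (m + k + 1)) (x m) := by
    intro m k
    induction k with
    | zero => exact hx m
    | succ k ih => exact (hx _).trans ih
  have hdir : IsDirected T (Set.range fun n => (x n : S)) := by
    rintro _ ⟨m, rfl⟩ _ ⟨n, rfl⟩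
    -- The index exceeds both `m` and `n` strictly, because `<` need not be reflexive.
    refine ⟨_, ⟨m + n + 1, rfl⟩, hlt m n, ?_⟩
    simpa only [Nat.add_comm m n] using hlt n m
  have hup : up T {c | g ∈ θ c} ⊆ {c | g ∈ θ c} := by
    rintro b ⟨c, hc, s, h⟩
    exact (hθ.mem_of_domVia h hc).2
  have htriple : {c | g ∈ θ c} * dual T {c | g ∈ θ c} * {c | g ∈ θ c} ⊆ {c | g ∈ θ c} := by
    rintro _ ⟨_, ⟨b, hb, s, ⟨c, hc, d, h⟩, rfl⟩, e, he, rfl⟩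
    change g ∈ θ (b * s * e)
    rw [hθ.map_mul, hθ.map_mul]
    -- The triple product contains `g` because `g = (gg⁻¹)g`.
    exact ⟨rng g, ⟨g, hb, inv g, (hθ.mem_of_domVia h hc).1, hG.composable_inv g, rfl⟩, g, he,
      hG.src_rng g, (hG.rng_mul_self g).symm⟩
  have hsub : (Set.range fun n => (x n : S)) ⊆ {c | g ∈ θ c} := by
    rintro _ ⟨n, rfl⟩
    exact (x n).2
  obtain ⟨D, hD, hDP⟩ := exists_dirCoset_subset hdir ⟨_, 0, rfl⟩ hup htriple hsub
  exact ⟨D, hD ⟨0, rfl⟩, fun c hc => hDP hc⟩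

end IsEtaleRepresentation

/-! ### Separation from faithful bundle representations -/

section Bundle

variable {F : Type v} {G : Type w} [ArrowOps F] [TopologicalSpace F] [ArrowOps G]
  [TopologicalSpace G] {π : F → G}

/-- A bundle is only assumed to preserve composability and products. Still, `π (src e)` is
idempotent, hence a unit, and is composable with `π e`, which identifies it. -/
theorem IsGroupoidBundle.map_src (h : IsGroupoidBundle π) (e : F) : π (src e) = src (π e) := by
  have hF := h.total.groupoid
  have hG := h.base.topological.groupoid
  have hu : π (src e) ∈ units G := by
    have hs := hF.src_mem_units e
    refine ⟨h.map_composable _ _ hs.1, ?_⟩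
    rw [← h.map_mul _ _ hs.1, hs.2]
  have hc : Composable (π e) (π (src e)) := h.map_composable _ _ (hF.rng_src e).symm
  rw [← hG.rng_eq_self hu]
  exact hc.symm

theorem IsGroupoidBundle.map_rng (h : IsGroupoidBundle π) (e : F) : π (rng e) = rng (π e) := by
  have hF := h.total.groupoid
  have hG := h.base.topological.groupoid
  have hu : π (rng e) ∈ units G := by
    rw [← hF.src_inv, h.map_src]; exact hG.src_mem_units _
  have hc : Composable (π (rng e)) (π e) := h.map_composable _ _ (hF.src_rng e)
  rw [← hG.src_eq_self hu]
  exact hc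

/-- Injectivity on units lifts the equality of source and range from the base to the total groupoid.
-/
theorem IsGroupoidBundle.composable_of_map (h : IsGroupoidBundle π) {e f : F}
    (hc : Composable (π e) (π f)) : Composable e f := by
  have hF := h.total.groupoid
  refine h.injOn_units (hF.src_mem_units e) (hF.rng_mem_units f) ?_
  rw [h.map_src, h.map_rng]; exact hc

/-- With `p` and `q` the values of `θ(s)` and `θ(t)` at `g⁻¹`, both `pxq` and `pyq` are the value of
`θ(sat) = θ(sbt)` there, and `p`, `q` cancel. -/
theorem IsBundleRepresentation.eq_of_sim {θ : S → (G →. F)} (h : IsBundleRepresentation T π θ)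
    {D : DirCoset T} {g : G} (hD : ∀ c ∈ D.carrier, g ∈ (θ c).Dom) {a b : S}
    (hab : Sim T D.carrier a b) {x y : F} (hx : x ∈ θ a g) (hy : y ∈ θ b g) : x = y := by
  have hF := h.bundle.total.groupoid
  have hG := h.bundle.base.topological.groupoid
  obtain ⟨-, -, s, hs, t, ht, e⟩ := D.sim_iff.1 hab
  have hdual : ∀ s ∈ dual T D.carrier, ∃ z, z ∈ θ s (inv g) := by
    rintro s ⟨c, hc, d, hcd⟩
    exact Part.dom_iff_mem.1 (h.etale_dom.mem_of_domVia hcd (hD c hc)).1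
  obtain ⟨p, hp⟩ := hdual s hs
  obtain ⟨q, hq⟩ := hdual t ht
  have hπ : ∀ {c k f}, f ∈ θ c k → π f = k := fun hf => (h.isSliceSection _).section_eq _ _ hf
  have key : ∀ {c z}, z ∈ θ c g → Composable p z ∧ Composable (mul p z) q ∧
      mul (mul p z) q ∈ θ (s * c * t) (inv g) := by
    intro c z hz
    have h1 : Composable p z := h.bundle.composable_of_map (by
      rw [hπ hp, hπ hz]; exact hG.inv_composable g)
    have h2 : mul p z ∈ θ (s * c) (src g) :=
      (h.map_mul s c _ _).2 ⟨_, _, p, z, hG.inv_composable g, hp, hz, rfl, rfl⟩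
    have hc : Composable (src g) (inv g) := (hG.src_src g).trans (hG.rng_inv g).symm
    have h3 : Composable (mul p z) q := h.bundle.composable_of_map (by
      rw [hπ h2, hπ hq]; exact hc)
    refine ⟨h1, h3, (h.map_mul (s * c) t _ _).2 ⟨_, _, _, q, hc, h2, hq, ?_, rfl⟩⟩
    rw [← hG.rng_inv, hG.rng_mul_self]
  obtain ⟨x1, x2, x3⟩ := key hx
  obtain ⟨y1, y2, y3⟩ := key hy
  rw [e] at x3
  exact hF.mul_left_cancel x1 y1 (hF.mul_right_cancel x2 y2 (Part.mem_unique x3 y3))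

/-- A faithful bundle representation yields directed cosets that separate the elements of `S`. -/
theorem IsBundleRepresentation.exists_not_sim {θ : S → (G →. F)}
    (h : IsBundleRepresentation T π θ) {a b : S} (hab : θ a ≠ θ b) :
    ∃ D : DirCoset T, (({a, b} : Set S) ∩ D.carrier).Nonempty ∧ ¬ Sim T D.carrier a b := by
  by_contra! hcon
  have key : ∀ {a b : S}, (∀ D : DirCoset T, a ∈ D.carrier → Sim T D.carrier a b) →
      ∀ g x, x ∈ θ a g → x ∈ θ b g := by
    intro a b hs g x hx
    obtain ⟨D, haD, hD⟩ := h.etale_dom.exists_dirCoset (Part.dom_iff_mem.2 ⟨x, hx⟩)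
    have hsim := hs D haD
    obtain ⟨y, hy⟩ := Part.dom_iff_mem.1 (hD b (D.sim_iff.1 hsim).2.1)
    rwa [h.eq_of_sim hD hsim hx hy]
  refine hab (funext fun g => Part.ext fun x =>
    ⟨key (fun D hD => ?_) g x, key (fun D hD => ?_) g x⟩)
  · exact hcon D ⟨a, Or.inl rfl, hD⟩
  · exact (hcon D ⟨b, Or.inr rfl, hD⟩).symm

end Bundle

/-- The maps `ã` and `b̃` agree precisely when `a ∼_D b` for every `D` in either domain, because
`∼_D` already includes membership of both elements in `D`. -/
theorem injective_dirCosetRep_iff : Function.Injective (dirCosetRep T) ↔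
    ∀ a b : S, a ≠ b → ∃ D : DirCoset T,
      (({a, b} : Set S) ∩ D.carrier).Nonempty ∧ ¬ Sim T D.carrier a b := by
  constructor
  · intro h a b hab
    by_contra! hcon
    have key : ∀ {a b : S}, (∀ D : DirCoset T, a ∈ D.carrier → Sim T D.carrier a b) →
        ∀ D p, p ∈ dirCosetRep T a D → p ∈ dirCosetRep T b D := by
      rintro a b hs D p ⟨ha, rfl⟩
      have hsim := hs D ha
      exact ⟨(D.sim_iff.1 hsim).2.1,
        (DirGerm.mk'_eq_mk'_iff (D.sim_iff.1 hsim).2.1 ha).2 ⟨rfl, hsim.symm⟩⟩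
    refine hab (h (funext fun D => Part.ext fun p =>
      ⟨key (fun D hD => ?_) D p, key (fun D hD => ?_) D p⟩))
    · exact hcon D ⟨a, Or.inl rfl, hD⟩
    · exact (hcon D ⟨b, Or.inr rfl, hD⟩).symm
  · intro h a b hab
    by_contra hne
    obtain ⟨D, hD, hs⟩ := h a b hne
    have key : a ∈ D.carrier → Sim T D.carrier a b := by
      intro ha
      have : DirGerm.mk' a D ha ∈ dirCosetRep T b D := hab ▸ ⟨ha, rfl⟩
      obtain ⟨hb, e⟩ := this
      exact ((DirGerm.mk'_eq_mk'_iff hb ha).1 e).2.symm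
    obtain ⟨x, rfl | rfl, hx⟩ := hD
    · exact hs (key hx)
    · refine hs (key ?_)
      have : DirGerm.mk' x D hx ∈ dirCosetRep T a D := hab ▸ ⟨hx, rfl⟩
      exact this.1

end BundleRep

theorem corollary11p19 {S : Type u} [Semigroup S] (T : BundleRep.StructuredSemigroup S)
    (hZ : BundleRep.IsSymmetric (T.Z : Set S)) :
    BundleRep.IsBundleRepresentation T (BundleRep.dirCosetBundle T) (BundleRep.dirCosetRep T) ∧
    List.TFAE
      [BundleRep.HasFaithfulBundleRepresentation.{u, max u v, max u w} T,
       Function.Injective (BundleRep.dirCosetRep T),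
       ∀ a b : S, a ≠ b → ∃ D : BundleRep.DirCoset T,
        (({a, b} : Set S) ∩ D.carrier).Nonempty ∧ ¬ BundleRep.Sim T D.carrier a b] := by
  have hrep := BundleRep.isBundleRepresentation_dirCosetRep hZ
  refine ⟨hrep, ?_⟩
  tfae_have 2 ↔ 3 := BundleRep.injective_dirCosetRep_iff
  -- The coset bundle lives in universe `u`, so it is lifted to the universes in which the first
  -- condition is stated.
  tfae_have 2 → 1 := fun h =>
    ⟨ULift.{v} _, ULift.{w} _, inferInstance, inferInstance, inferInstance, inferInstance, _, _,
      hrep.ulift, BundleRep.injective_map_up h⟩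
  tfae_have 1 → 3 := by
    rintro ⟨F, G, _, _, _, _, π, θ, hθ, hinj⟩ a b hab
    exact hθ.exists_not_sim (hinj.ne hab)
  tfae_finish
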